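/- Let $p>2$ be a prime, $\mathbb F$ a finite field of characteristic $p$, $W=W(\mathbb F)$ its ring of Witt vectors, and let $A$ be a compact Hausdorff local topological $W$-algebra with maximal ideal $\mathfrak m$ such that $W\to A/\mathfrak m$ is surjective (so $A/\mathfrak m=\mathbb F$). Let $s:\mathbb F\to A$ be the Teichmüller map. Let $(\Pi,\bar\rho,t,d)$ be an admissible pseudo-deformation over $A$, that is: $\Pi$ is a profinite group such that the maximal pro-$p$ quotient of every open subgroup is topologically finitely generated; $\bar\rho:\Pi\to GL_2(\mathbb F)$ is a continuous representation which is absolutely irreducible or a sum of two distinct characters; $t:\Pi\to A$ and $d:\Pi\to A^*$ are continuous, $d$ is a homomorphism, $t(xy)=t(yx)$, $t(1)=2$ and $t(xy)+d(y)t(xy^{-1})=t(x)t(y)$ for all $x,y\in\Pi$; $t\equiv\mathrm{tr}\,\bar\rho$ and $d\equiv\det\bar\rho$ modulo $\mathfrak m$; $d(\Pi)\subset s(\mathbb F)$; and $t(\Pi)$ generates $A$ as a topological $W$-algebra. Assume that the projective image of $\bar\rho$ is a dihedral group of order $n$ with $n>4$ and $4\mid n$ (so $\bar\rho$ is irreducible).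 A $(t,d)$-representation is then a homomorphism $\rho:\Pi\to GL_2(A)$ with $\mathrm{tr}\,\rho=t$, $\det\rho=d$ and $A\rho(\Pi)=M_2(A)$. Essential submodule. Let $\rho'$ be a $(t,d)$-representation, $G=\rho'(\Pi)$, $\Gamma=\{\gamma\in G:\det\gamma=1,\ \gamma\equiv 1 \bmod \mathfrak m M_2(A)\}$, $\Theta(x)=x-\tfrac12\mathrm{tr}(x)\,\mathrm{Id}$, let $L$ be the closed additive subgroup of $M_2(A)$ generated by $\Theta(\Gamma)$, and $L_2$ the closed additive subgroup generated by the commutators $xy-yx$, $x,y\in L$. Let $S$ be the set of $g\in G$ with $\mathrm{tr}\,g=0$ and $-\det g$ a square in $A^*$. Put $A_{\mathrm{ess}}=\sum_{g\in S}W\,\mathrm{tr}(gL_2)\subset A$. Well-adapted representation. Let $\rho$ be a $(t,d)$-representation whose reduction modulo $\mathfrak m$ is $\bar\rho$, with image $\bar G=\bar\rho(\Pi)$, and let $g_0\in\Pi$ be such that: $\rho(g_0)$ is diagonal with diagonal entries distinct modulo $\mathfrak m$; the subgroup $D$ of $\bar G$ generated by $\bar\rho(g_0)$ and the scalar matrices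 of $\bar G$ has index $2$ in $\bar G$; the entrywise Teichmüller lift of every element of $\bar G$ belongs to $\rho(\Pi)$; and $\bar G$ contains a matrix $\begin{pmatrix}0&b\\c&0\end{pmatrix}$ with $b c^{-1}\in\mathbb F_p^*$. The $A$-module spanned by $\rho(\bar\rho^{-1}(D))$ is then a generalized matrix algebra $\begin{pmatrix}A&B\\B&A\end{pmatrix}\subset M_2(A)$; let $B$ be the ideal of $A$ formed by its upper right entries. Theorem. Assume that some element $\bar g'\in\bar G-D$ has trace $0$ and $-\det\bar g'$ a square in $\mathbb F^*$. Then, for every $(t,d)$-representation $\rho'$ and every well-adapted $\rho$ as above: (1) $A_{\mathrm{ess}}$ is an ideal of $A$; (2) $A_{\mathrm{ess}}+pB=\mathfrak m B$; (3) if $pA=0$, then $A_{\mathrm{ess}}=\mathfrak m B$. -/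

import Mathlib

open scoped MatrixGroups

namespace DihedralEssential

noncomputable section

/-! ### Profinite groups and Mazur's finiteness condition -/

/-- The intersection of all open normal subgroups of `p`-power index of a topological group `H`;
for `H` profinite, the quotient by it is the largest pro-`p` quotient of `H`. -/
def proPKernel (p : ℕ) (H : Type*) [Group H] [TopologicalSpace H] : Subgroup H :=
  sInf {N : Subgroup H | N.Normal ∧ IsOpen (N : Set H) ∧ ∃ k : ℕ, N.index = p ^ k}

instance proPKernel_normal (p : ℕ) (H : Type*) [Group H] [TopologicalSpace H] :
    (proPKernel p H).Normal := by
  refine ⟨fun n hn g => ?_⟩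
  rw [proPKernel, Subgroup.mem_sInf] at hn ⊢
  intro N hN
  exact hN.1.conj_mem n (hn N hN) g

/-- `G` has a dense finitely generated subgroup. -/
def TopFG (G : Type*) [Group G] [TopologicalSpace G] : Prop :=
  ∃ s : Finset G, Dense (Subgroup.closure (s : Set G) : Set G)

/-- Mazur's `p`-finiteness condition: the largest pro-`p` quotient of every open subgroup is
topologically finitely generated. -/
def PFinite (p : ℕ) (P : Type*) [Group P] [TopologicalSpace P] : Prop :=
  ∀ H : Subgroup P, IsOpen (H : Set P) → TopFG (H ⧸ proPKernel p H)

/-! ### Residual representations -/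

section Residual

variable {F P : Type*} [Field F] [Group P]

/-- A two-dimensional representation is absolutely irreducible: over an algebraic closure there is
no invariant line. -/
def AbsIrreducible (r : P →* GL (Fin 2) F) : Prop :=
  ∀ v : Fin 2 → AlgebraicClosure F,
    (∀ g : P, ∃ c : AlgebraicClosure F,
      ((r g).val.map (algebraMap F (AlgebraicClosure F))).mulVec v = c • v) → v = 0

/-- The representation is isomorphic to the direct sum of two distinct characters. -/
def IsSumOfDistinctCharacters (r : P →* GL (Fin 2) F) : Prop :=
  ∃ (χ₁ χ₂ : P →* Fˣ) (Q : GL (Fin 2) F), χ₁ ≠ χ₂ ∧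
    ∀ g : P, (Q * r g * Q⁻¹).val = Matrix.diagonal ![(χ₁ g : F), (χ₂ g : F)]

/-- The projective image: the image of the representation in `PGL₂(F)`. -/
def projImage (r : P →* GL (Fin 2) F) : Subgroup (PGL(2, F)) :=
  (Matrix.ProjGenLinGroup.mk.comp r).range

/-- The projective image is a dihedral group of order `n`. -/
def IsDihedralOfOrder (r : P →* GL (Fin 2) F) (n : ℕ) : Prop :=
  Nat.card (projImage r) = n ∧ ∃ k : ℕ, Nonempty (projImage r ≃* DihedralGroup k)

/-- The set `S̄`: elements of the residual image of trace zero such that `-det` is a square. -/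
def residualS (r : P →* GL (Fin 2) F) : Set (GL (Fin 2) F) :=
  {x | x ∈ r.range ∧ x.val.trace = 0 ∧ IsSquare (-Matrix.GeneralLinearGroup.det x)}

/-- The subgroup `D` of the residual image generated by the image of `g₀` and by the scalar
matrices in the residual image. -/
def diagSubgroup (r : P →* GL (Fin 2) F) (g₀ : P) : Subgroup (GL (Fin 2) F) :=
  Subgroup.closure ({r g₀} ∪ {x | x ∈ r.range ∧ ∃ c : F, x.val = Matrix.scalar (Fin 2) c})

end Residual

/-! ### Pseudo-representations and admissible pseudo-deformations -/

/-- Two-dimensional pseudo-representations `(t, d)` of a group with values in `A`. -/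
structure IsPseudoRep {P A : Type*} [Group P] [CommRing A] (t : P → A) (d : P →* Aˣ) : Prop where
  central : ∀ x y, t (x * y) = t (y * x)
  one : t 1 = 2
  mul : ∀ x y, t (x * y) + (d y : A) * t (x * y⁻¹) = t x * t y

section Base

variable (p : ℕ) [Fact p.Prime] (F : Type*) [Field F]
  (A : Type*) [CommRing A] [Algebra (WittVector p F) A]

/-- The Teichmüller section `s : F → A`. -/
def teich (x : F) : A := algebraMap (WittVector p F) A (WittVector.teichmuller p x)

variable [IsLocalRing A]

/-- `W(F) → A / 𝔪` is surjective, so that `A / 𝔪` is identified with `F`; under this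
identification the class of `teich p F A x` is `x`. -/
def ResidueFieldIs : Prop :=
  Function.Surjective
    ((IsLocalRing.residue A).comp (algebraMap (WittVector p F) A))

variable {F A}

/-- `a ∈ A` reduces to `x ∈ F` modulo the maximal ideal. -/
def ReducesTo (a : A) (x : F) : Prop := a - teich p F A x ∈ IsLocalRing.maximalIdeal A

/-- The tuple `(P, r, t, d)` is an admissible pseudo-deformation over the local ring `A`
(the group `P` being moreover compact and totally disconnected). The continuity of `r`, whose
target is a finite discrete group, is the openness of its kernel. -/
structure IsAdmissible [TopologicalSpace A] {P : Type*} [Group P] [TopologicalSpace P]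
    (r : P →* GL (Fin 2) F) (t : P → A) (d : P →* Aˣ) : Prop where
  pFinite : PFinite p P
  rep_continuous : IsOpen (r.ker : Set P)
  rep_multFree : AbsIrreducible r ∨ IsSumOfDistinctCharacters r
  pseudo : IsPseudoRep t d
  t_continuous : Continuous t
  d_continuous : Continuous fun g => (d g : A)
  t_reduces : ∀ g, ReducesTo p (t g) (r g).val.trace
  d_reduces : ∀ g, ReducesTo p (d g : A) (r g).val.det
  d_constant : ∀ g, ∃ x : F, (d g : A) = teich p F A x
  generated : Dense (Algebra.adjoin (WittVector p F) (Set.range t) : Set A)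

end Base

/-! ### Representations with given trace and determinant; Pink's Lie algebra -/

section Lie

variable {A P : Type*} [CommRing A] [Group P]

/-- `ρ : P → GL₂(A)` is a `(t, d)`-representation: its trace is `t`, its determinant is `d`, and
its image spans `M₂(A)` over `A`. -/
structure IsTDRep (t : P → A) (d : P →* Aˣ) (ρ : P →* GL (Fin 2) A) : Prop where
  trace_eq : ∀ g, (ρ g).val.trace = t g
  det_eq : ∀ g, Matrix.GeneralLinearGroup.det (ρ g) = d g
  span_eq : Submodule.span A (Set.range fun g => (ρ g).val) = ⊤

/-- The group `Γ`: the matrices of determinant `1` in the image of `ρ` which are congruent to the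
identity modulo the radical `M₂(𝔪)` of `M₂(A)`. -/
def pinkGamma [IsLocalRing A] (ρ : P →* GL (Fin 2) A) : Set (Matrix (Fin 2) (Fin 2) A) :=
  {M | (∃ g : P, (ρ g).val = M) ∧ M.det = 1 ∧
    ∀ i j, (M - 1) i j ∈ IsLocalRing.maximalIdeal A}

/-- Pink's map `Θ(x) = x - (tr x / 2) • Id`, used only when `2` is invertible. -/
def pinkTheta (x : Matrix (Fin 2) (Fin 2) A) : Matrix (Fin 2) (Fin 2) A :=
  x - (Ring.inverse (2 : A) * x.trace) • (1 : Matrix (Fin 2) (Fin 2) A)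

variable [TopologicalSpace A] [IsTopologicalRing A]

/-- Pink's Lie algebra `L` of `Γ`: the closed additive subgroup generated by `Θ(Γ)`. -/
def pinkLie [IsLocalRing A] (ρ : P →* GL (Fin 2) A) : AddSubgroup (Matrix (Fin 2) (Fin 2) A) :=
  (AddSubgroup.closure (pinkTheta '' pinkGamma ρ)).topologicalClosure

/-- `[X, Y]`: the closed additive subgroup generated by all commutators `x y - y x`. -/
def closedBracket (X Y : AddSubgroup (Matrix (Fin 2) (Fin 2) A)) :
    AddSubgroup (Matrix (Fin 2) (Fin 2) A) :=
  (AddSubgroup.closure {z | ∃ x ∈ X, ∃ y ∈ Y, z = x * y - y * x}).topologicalClosure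

/-- The derived Lie algebra `L₂ = [L, L]`. -/
def pinkLie₂ [IsLocalRing A] (ρ : P →* GL (Fin 2) A) : AddSubgroup (Matrix (Fin 2) (Fin 2) A) :=
  closedBracket (pinkLie ρ) (pinkLie ρ)

/-- The set `S`: elements `g` of the image of `ρ` with `tr g = 0` and `-det g` a square in `Aˣ`. -/
def essentialS (ρ : P →* GL (Fin 2) A) : Set (GL (Fin 2) A) :=
  {g | g ∈ ρ.range ∧ g.val.trace = 0 ∧ IsSquare (-Matrix.GeneralLinearGroup.det g)}

/-- The essential submodule: the sum over `g ∈ S` of the `W(F)`-submodules generated by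
`tr (g L₂)`. -/
def essentialSubmodule (p : ℕ) [Fact p.Prime] (F : Type*) [Field F] [Algebra (WittVector p F) A]
    [IsLocalRing A] (ρ : P →* GL (Fin 2) A) : Submodule (WittVector p F) A :=
  ⨆ g ∈ essentialS ρ,
    Submodule.span (WittVector p F) {a | ∃ x ∈ pinkLie₂ ρ, a = (g.val * x).trace}

end Lie

/-! ### Well-adapted representations in the dihedral case -/

section WellAdapted

variable {A P : Type*} [CommRing A] [IsLocalRing A] [Group P]
  (p : ℕ) [Fact p.Prime] {F : Type*} [Field F] [Algebra (WittVector p F) A]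

/-- `ρ` is well adapted, with respect to the element `g₀`, and its reduction modulo the maximal
ideal is `r` (dihedral case). -/
structure IsWellAdapted (r : P →* GL (Fin 2) F) (ρ : P →* GL (Fin 2) A) (g₀ : P) : Prop where
  /-- `r` is the reduction of `ρ` -/
  reduction : ∀ g i j, ReducesTo p ((ρ g).val i j) ((r g).val i j)
  /-- `ρ(g₀)` is diagonal, with diagonal entries reducing to two distinct elements of `F` -/
  adapted : (ρ g₀).val 0 1 = 0 ∧ (ρ g₀).val 1 0 = 0 ∧ (r g₀).val 0 0 ≠ (r g₀).val 1 1
  /-- `r(g₀)` and the scalar matrices generate a subgroup of index `2` of the image of `r` -/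
  index_two : (diagSubgroup r g₀).relIndex r.range = 2
  /-- the entrywise Teichmüller lifts of the elements of the image of `r` are in the image of `ρ` -/
  teich_mem : ∀ h : P, ∃ g : P, (ρ g).val = (r h).val.map (teich p F A)
  /-- the image of `r` contains an antidiagonal matrix with entries `b`, `c` such that `b / c` is
  in the prime field -/
  antidiag : ∃ h : P, (r h).val 0 0 = 0 ∧ (r h).val 1 1 = 0 ∧
    (r h).val 0 1 / (r h).val 1 0 ∈ (⊥ : Subfield F)

/-- The `A`-submodule of `M₂(A)` spanned by the image under `ρ` of the index `2` subgroup
`r⁻¹(D)`; for well-adapted `ρ` it is a generalized matrix algebra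
`{M ∈ M₂(A) | M₀₁ ∈ B, M₁₀ ∈ B}` for an ideal `B` of `A`. -/
def indexTwoAlgebra (r : P →* GL (Fin 2) F) (ρ : P →* GL (Fin 2) A) (g₀ : P) :
    Submodule A (Matrix (Fin 2) (Fin 2) A) :=
  Submodule.span A ((fun g => (ρ g).val) '' ((diagSubgroup r g₀).comap r : Set P))

/-- The off-diagonal ideal `B`: the ideal of upper right entries of `indexTwoAlgebra`. -/
def offDiagIdeal (r : P →* GL (Fin 2) F) (ρ : P →* GL (Fin 2) A) (g₀ : P) : Ideal A :=
  (indexTwoAlgebra r ρ g₀).map (Matrix.entryLinearMap A A (0 : Fin 2) (1 : Fin 2))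

end WellAdapted

end

end DihedralEssential

open DihedralEssential

open DihedralEssential

set_option linter.unusedSectionVars false

namespace DihedralEssential

section

open Topology Filter

/-! ### Topological nilpotence in compact rings. -/

section CompactRing

variable {R : Type*} [Ring R] [TopologicalSpace R] [IsTopologicalRing R] [CompactSpace R]

/-! The `W(F)`-span of Pink's Lie algebra `L` is stable under conjugation by the image of `ρ`, hence
by the Teichmüller lift of `r g₀` and by that of an antidiagonal matrix. Since `n > 4` and `4 ∣ n`,
the ratio `z` of the eigenvalues of `r g₀` satisfies `z² ≠ 1`, so the weights `1`, `z`, `z⁻¹` stay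
distinct modulo `p`. The span therefore splits into matrices `diag(a, -a)` with `a ∈ I₁` and two
off-diagonal parts, both given by one module `B₁` (`IsTorusStable`). The span of `L₂` splits in the
same way, with modules `J₀` and `K`.

Computing brackets, and using that `2` is a unit, shows that `J₀` and `K` are the smallest closed
submodules containing `B₁B₁` and `I₁B₁`. As `L₂ ⊆ L`, also `J₀ ⊆ I₁` and `K ⊆ B₁`. Hence
multiplication by `I₁` or `B₁` preserves `J₀ + K`. These two modules generate `A` topologically: an
element of `Γ` is recovered from its image under `Θ` by extracting a square root, and `ρ(Π)` is `Γ`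
times Teichmüller lifts (`IsWellAdapted.eq_top_of_isClosed`). So `J₀ + K` is an ideal
(`exists_ideal_eq_sup`).

It is the essential submodule (`IsWellAdapted.essentialSubmodule_eq_sup`). Pairing `L₂` with a trace
zero diagonal element of `S` yields `J₀`, pairing with an antidiagonal one yields `K`, and every
other pairing stays in the ideal. The choice of `ρ'` is immaterial because `(t, d)`-representations
are intertwined by a trace-preserving algebra map.

Finally `B` is generated by `B₁`. Modulo `p` and the annihilator of `B₁` in `A / (J₀ + K)`, every
element of `A` is a constant and every element of `𝔪` vanishes, so `𝔪B ⊆ J₀ + K + pB`. The opposite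
inclusion needs `𝔪B` closed, which follows from finite generation of `B`, a consequence of Mazur's
condition (`IsWellAdapted.offDiagIdeal_fg`). -/

theorem exists_nhds_forall_mul_mem {V : Set R} (hV : V ∈ 𝓝 (0 : R)) :
    ∃ U ∈ 𝓝 (0 : R), ∀ u ∈ U, ∀ a, u * a ∈ V := by
  obtain ⟨V', hV', hVo, h0⟩ := mem_nhds_iff.1 hV
  have ho : IsOpen ((fun x : R × R => x.1 * x.2) ⁻¹' V') := hVo.preimage continuous_mul
  obtain ⟨u, v, hu, -, hsu, hsv, huv⟩ := generalized_tube_lemma (s := {(0 : R)}) isCompact_singleton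
    (t := Set.univ) isCompact_univ ho (by rintro ⟨a, b⟩ ⟨ha, -⟩; simp_all)
  exact ⟨u, hu.mem_nhds (hsu rfl), fun x hx a => hV' (huv (Set.mk_mem_prod hx (hsv trivial)))⟩

/-- Powers of `x` tend to zero, uniformly after multiplication by any element. -/
def IsTopNil (x : R) : Prop := ∀ V ∈ 𝓝 (0 : R), ∃ N, ∀ n ≥ N, ∀ a, x ^ n * a ∈ V

/-- The closure of the powers of `x` is a compact semigroup, so it contains an idempotent, which
must be `0`. Thus some power of `x` is small, and by compactness so are all its multiples. -/
theorem isTopNil_of_idempotent [T2Space R] {S : Subsemigroup R} (hS : IsClosed (S : Set R))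
    (hid : ∀ e ∈ S, e * e = e → e = 0) {x : R} (hx : x ∈ S) : IsTopNil x := by
  intro V hV
  obtain ⟨U, hU, hUV⟩ := exists_nhds_forall_mul_mem hV
  let T := (Subsemigroup.closure {x}).topologicalClosure
  have hTS : T ≤ S := Subsemigroup.topologicalClosure_minimal _ (by simpa using hx) hS
  obtain ⟨e, heT, he⟩ := exists_idempotent_in_compact_subsemigroup
    (fun r : R => continuous_mul_const r) (T : Set R)
    ⟨x, Subsemigroup.le_topologicalClosure _ (Subsemigroup.subset_closure rfl)⟩
    (Subsemigroup.isClosed_topologicalClosure _).isCompact (fun a ha b hb => T.mul_mem ha hb)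
  have he0 : e = 0 := hid e (hTS heT) he
  subst he0
  have hcl : (0 : R) ∈ closure ((Subsemigroup.closure {x} : Subsemigroup R) : Set R) := heT
  obtain ⟨y, hyU, hy⟩ := mem_closure_iff_nhds.1 hcl U hU
  have hpow : ∀ y ∈ Subsemigroup.closure {x}, ∃ n : ℕ, y = x ^ n := by
    intro y hy
    induction hy using Subsemigroup.closure_induction with
    | mem z hz => exact ⟨1, by simpa using hz⟩
    | mul a b _ _ ha hb =>
      obtain ⟨m, rfl⟩ := ha
      obtain ⟨n, rfl⟩ := hb
      exact ⟨m + n, (pow_add x m n).symm⟩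
  obtain ⟨N, rfl⟩ := hpow y hy
  refine ⟨N, fun n hn a => ?_⟩
  obtain ⟨k, rfl⟩ := Nat.exists_eq_add_of_le hn
  rw [pow_add, mul_assoc]
  exact hUV _ hyU _

open Polynomial in
-- Modulo `X ^ p ^ k` the polynomial `(1 + X) ^ p ^ k` has the form `1 + p y`, and the `p ^ j`-th
-- power of the latter is `1` modulo `p ^ (j + 1)`. An identity in `ℤ[X]` can be evaluated at one
-- element of a noncommutative ring.
theorem one_add_X_pow_prime_pow (p : ℕ) (hp : p.Prime) (k j : ℕ) :
    ∃ f g : ℤ[X], (1 + X) ^ p ^ (k + j) = 1 + X ^ p ^ k * f + (p : ℤ[X]) ^ (j + 1) * g := by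
  obtain ⟨y, hy⟩ := exists_add_pow_prime_pow_eq hp (1 : ℤ[X]) X k
  have h1 : (X : ℤ[X]) ^ p ^ k ∣ ((1 + X) ^ p ^ k) ^ p ^ j -
      (1 + (p : ℤ[X]) * (1 * X * y)) ^ p ^ j := by
    refine dvd_trans ?_ (sub_dvd_pow_sub_pow _ _ _)
    exact ⟨1, by rw [hy]; ring⟩
  have h2 : (p : ℤ[X]) ^ (j + 1) ∣ (1 + (p : ℤ[X]) * (1 * X * y)) ^ p ^ j - 1 ^ p ^ j :=
    dvd_sub_pow_of_dvd_sub ⟨1 * X * y, by ring⟩ j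
  obtain ⟨f, hf⟩ := h1
  obtain ⟨g, hg⟩ := h2
  refine ⟨f, g, ?_⟩
  rw [pow_add, pow_mul, ← hf, ← hg]
  ring

theorem tendsto_one_add_pow {p : ℕ} (hp : p.Prime) {x : R} (hx : IsTopNil x)
    (hpR : IsTopNil (p : R)) : Tendsto (fun n => (1 + x) ^ p ^ n) atTop (𝓝 1) := by
  have key : Tendsto (fun n => (1 + x) ^ p ^ n - 1) atTop (𝓝 0) := by
    intro V hV
    have hadd : Tendsto (fun z : R × R => z.1 + z.2) (𝓝 (0, 0)) (𝓝 0) := by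
      simpa using (continuous_add (M := R)).tendsto (0, 0)
    have := hadd hV
    rw [nhds_prod_eq, mem_map, mem_prod_iff] at this
    obtain ⟨V₁, hV₁, V₂, hV₂, hVV⟩ := this
    obtain ⟨N₁, hN₁⟩ := hx V₁ hV₁
    obtain ⟨N₂, hN₂⟩ := hpR V₂ hV₂
    rw [mem_map, mem_atTop_sets]
    refine ⟨N₁ + N₂, fun n hn => ?_⟩
    obtain ⟨j, rfl⟩ := Nat.exists_eq_add_of_le (le_trans (Nat.le_add_right N₁ N₂) hn)
    obtain ⟨f, g, hfg⟩ := one_add_X_pow_prime_pow p hp N₁ j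
    have h := congrArg (Polynomial.aeval x) hfg
    simp only [map_pow, map_add, map_one, map_mul, Polynomial.aeval_X, map_natCast] at h
    have : (1 + x) ^ p ^ (N₁ + j) - 1 = x ^ p ^ N₁ * Polynomial.aeval x f +
        (p : R) ^ (j + 1) * Polynomial.aeval x g := by rw [h]; abel
    rw [Set.mem_preimage, this]
    exact hVV (Set.mk_mem_prod (hN₁ _ (Nat.lt_pow_self hp.one_lt).le _) (hN₂ _ (by omega) _))
  simpa using key.add_const 1

end CompactRing

/-! ### Teichmüller lifts and units coming from Witt vectors. -/

section Teichmuller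

variable (p : ℕ) [Fact p.Prime] {F : Type*} [Field F]
  {A : Type*} [CommRing A] [Algebra (WittVector p F) A]

theorem teich_mul (x y : F) : teich p F A (x * y) = teich p F A x * teich p F A y := by
  simp [teich]

theorem teich_one : teich p F A 1 = 1 := by simp [teich]

theorem teich_zero : teich p F A 0 = 0 := by simp [teich, WittVector.teichmuller_zero]

theorem isUnit_teich {x : F} (hx : x ≠ 0) : IsUnit (teich p F A x) :=
  IsUnit.of_mul_eq_one (teich p F A x⁻¹) (by rw [← teich_mul, mul_inv_cancel₀ hx, teich_one])

theorem teich_mem_maximalIdeal [IsLocalRing A] {x : F} :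
    teich p F A x ∈ IsLocalRing.maximalIdeal A ↔ x = 0 := by
  refine ⟨fun h => ?_, fun h => by rw [h, teich_zero]; exact zero_mem _⟩
  by_contra hx
  exact h (isUnit_teich p hx)

variable [CharP F p]

theorem exists_eq_add_p_mul [PerfectRing F p] (w v : WittVector p F)
    (h : w.coeff 0 = v.coeff 0) : ∃ u, w = v + p * u := by
  have : (w - v) ∈ Ideal.span {(p : WittVector p F)} := by
    rw [← WittVector.ker_constantCoeff, RingHom.mem_ker, map_sub]
    simpa [WittVector.constantCoeff_apply, sub_eq_zero] using h
  obtain ⟨u, hu⟩ := Ideal.mem_span_singleton'.1 this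
  exact ⟨u, by rw [mul_comm, hu]; ring⟩

theorem isUnit_two (hp : p ≠ 2) : IsUnit (2 : WittVector p F) := by
  refine WittVector.isUnit_of_coeff_zero_ne_zero _ ?_
  have h2 : WittVector.constantCoeff (2 : WittVector p F) = 2 := map_ofNat _ 2
  intro h
  have h0 : ((2 : ℕ) : F) = 0 := by exact_mod_cast h2.symm.trans h
  have := (Nat.dvd_prime Nat.prime_two).1 ((CharP.cast_eq_zero_iff F p 2).1 h0)
  exact this.elim (Fact.out : p.Prime).ne_one hp

theorem isUnit_two_algebra {F : Type*} [Field F] [CharP F p] [Algebra (WittVector p F) A]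
    (hp : p ≠ 2) : IsUnit (2 : A) := by
  have h := (isUnit_two p (F := F) hp).map (algebraMap (WittVector p F) A)
  have e : algebraMap (WittVector p F) A 2 = 2 := map_ofNat (algebraMap (WittVector p F) A) 2
  rwa [e] at h

theorem teich_neg (hp : p ≠ 2) (x : F) : teich p F A (-x) = -teich p F A x := by
  have hsq : WittVector.teichmuller p (-1 : F) * WittVector.teichmuller p (-1 : F) = 1 := by
    rw [← map_mul]; simp
  -- The lift of `-1` is a square root of `1`. Its difference with `1` reduces to `2 ≠ 0`, which
  -- excludes the root `1`.
  have h1 : IsUnit (1 - WittVector.teichmuller p (-1 : F)) := by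
    refine WittVector.isUnit_of_coeff_zero_ne_zero _ ?_
    have hc : (1 - WittVector.teichmuller p (-1 : F)).coeff 0 = 2 := by
      refine (map_sub (WittVector.constantCoeff (p := p)) _ _).trans ?_
      rw [map_one, WittVector.constantCoeff_apply, WittVector.teichmuller_coeff_zero]
      norm_num
    rw [hc]
    intro h
    have h0 : ((2 : ℕ) : F) = 0 := by exact_mod_cast h
    have := (Nat.dvd_prime Nat.prime_two).1 ((CharP.cast_eq_zero_iff F p 2).1 h0)
    exact this.elim (Fact.out : p.Prime).ne_one hp
  have h2 : WittVector.teichmuller p (-1 : F) = -1 := by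
    have h3 : (1 - WittVector.teichmuller p (-1 : F)) *
        (1 + WittVector.teichmuller p (-1 : F)) = 0 := by
      linear_combination -hsq
    exact (neg_eq_of_add_eq_zero_right (h1.mul_right_eq_zero.1 h3)).symm
  rw [neg_eq_neg_one_mul x, teich_mul]
  simp [teich, h2]

variable [IsLocalRing A]

open IsLocalRing

theorem isUnit_teichmuller_sub {x y : F} (h : x ≠ y) :
    IsUnit (WittVector.teichmuller p x - WittVector.teichmuller p y) := by
  refine WittVector.isUnit_of_coeff_zero_ne_zero _ ?_
  have hc : (WittVector.teichmuller p x - WittVector.teichmuller p y).coeff 0 = x - y := by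
    refine (map_sub (WittVector.constantCoeff (p := p)) _ _).trans ?_
    simp [WittVector.constantCoeff_apply, WittVector.teichmuller_coeff_zero]
  rw [hc]
  exact sub_ne_zero.2 h

theorem teich_eq_of_sub_mem {x y : F} (h : teich p F A x - teich p F A y ∈ maximalIdeal A) :
    x = y := by
  by_contra hxy
  refine (show ¬IsUnit (teich p F A x - teich p F A y) from h) ?_
  have := (isUnit_teichmuller_sub p hxy).map (algebraMap (WittVector p F) A)
  rwa [map_sub] at this

theorem ReducesTo.unique {a : A} {x y : F} (hx : ReducesTo p a x)
    (hy : ReducesTo p a y) : x = y := by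
  refine teich_eq_of_sub_mem p (A := A) ?_
  have := sub_mem hy hx
  rwa [sub_sub_sub_cancel_left] at this

/-- If `p` were invertible, its inverse would be residually some Witt vector `w`. Then `1 - p w`, a
unit of `W(F)`, would vanish in the residue field. -/
theorem natCast_p_mem_maximalIdeal (hA : ResidueFieldIs p F A) : (p : A) ∈ maximalIdeal A := by
  intro hu
  obtain ⟨v, hv⟩ := hu
  obtain ⟨w, hw⟩ := hA (residue A ((v⁻¹ : Aˣ) : A))
  have h1 : IsUnit (1 - p * w : WittVector p F) := by
    apply WittVector.isUnit_of_coeff_zero_ne_zero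
    have : WittVector.constantCoeff (1 - p * w : WittVector p F) = 1 := by
      rw [map_sub, map_one, map_mul, map_natCast, CharP.cast_eq_zero, zero_mul, sub_zero]
    exact fun h => one_ne_zero (this.symm.trans h)
  have h2 := h1.map ((residue A).comp (algebraMap (WittVector p F) A))
  rw [map_sub, map_mul, hw] at h2
  simp only [map_one, map_natCast] at h2
  rw [← map_natCast (residue A) p, ← map_mul, ← hv] at h2
  simp at h2

end Teichmuller

/-! ### Closed `W(F)`-submodules. -/

section WittModule

open Pointwise

variable (p : ℕ) [Fact p.Prime] {F : Type*} [Field F] [CharP F p] [Finite F]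
  {R : Type*} [Ring R] [TopologicalSpace R] [IsTopologicalRing R] [CompactSpace R]
  [Algebra (WittVector p F) R]

/-- A truncated Teichmüller expansion of `w` puts `w • n` in `N` up to a multiple of `p ^ k`. These
errors tend to zero and `N` is closed. -/
theorem witt_smul_mem_of_isClosed (hpR : IsTopNil (p : R)) {N : AddSubgroup R}
    (hN : IsClosed (N : Set R))
    (hs : ∀ (x : F), ∀ n ∈ N, WittVector.teichmuller p x • n ∈ N) (w : WittVector p F) {n : R}
    (hn : n ∈ N) : w • n ∈ N := by
  have key : ∀ k : ℕ, ∀ w : WittVector p F, ∃ u : WittVector p F,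
      w • n - (p : R) ^ k * (u • n) ∈ N := by
    intro k
    induction k with
    | zero => exact fun w => ⟨w, by simp⟩
    | succ k ih =>
      intro w
      obtain ⟨v, hv⟩ := exists_eq_add_p_mul p w (WittVector.teichmuller p (w.coeff 0))
        (by rw [WittVector.teichmuller_coeff_zero])
      obtain ⟨u, hu⟩ := ih v
      refine ⟨u, ?_⟩
      have h2 : w • n = WittVector.teichmuller p (w.coeff 0) • n + (p : R) * (v • n) := by
        conv_lhs => rw [hv]
        rw [add_smul, mul_smul, ← nsmul_eq_mul, Nat.cast_smul_eq_nsmul]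
      have e : w • n - (p : R) ^ (k + 1) * (u • n) = WittVector.teichmuller p (w.coeff 0) • n +
          p • (v • n - (p : R) ^ k * (u • n)) := by
        rw [h2, nsmul_eq_mul, pow_succ']; noncomm_ring
      rw [e]
      exact add_mem (hs _ _ hn) (N.nsmul_mem hu p)
  have : w • n ∈ closure (N : Set R) := by
    rw [mem_closure_iff_nhds]
    intro V hV
    have hc : Tendsto (fun z : R => w • n - z) (𝓝 0) (𝓝 (w • n)) := by
      have h0 : Tendsto (fun z : R => w • n - z) (𝓝 0) (𝓝 (w • n - 0)) :=
        tendsto_const_nhds.sub tendsto_id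
      rwa [sub_zero] at h0
    obtain ⟨k, hk⟩ := hpR _ (hc hV)
    obtain ⟨u, hu⟩ := key k w
    exact ⟨_, hk k le_rfl (u • n), hu⟩
  rwa [hN.closure_eq] at this

/-- As `F` is finite, the sums of Teichmüller multiples of elements of `M` form a continuous image
of the compact space `F → M`. This image is closed and Teichmüller-stable, so it is already the
whole span. -/
theorem isClosed_witt_span [T2Space R] (hpR : IsTopNil (p : R)) {M : AddSubgroup R}
    (hM : IsClosed (M : Set R)) :
    IsClosed (Submodule.span (WittVector p F) (M : Set R) : Set R) := by
  classical
  have := Fintype.ofFinite F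
  let f : (F → M) →+ R :=
    { toFun := fun m => ∑ x, WittVector.teichmuller p x • (m x : R)
      map_zero' := by simp
      map_add' := fun a b => by simp [smul_add, Finset.sum_add_distrib] }
  have hfc : Continuous f := by
    refine continuous_finsetSum _ fun x _ => ?_
    simp_rw [Algebra.smul_def]
    exact continuous_const.mul (continuous_subtype_val.comp (continuous_apply x))
  have : CompactSpace M := isCompact_iff_compactSpace.1 hM.isCompact
  have hcl : IsClosed (f.range : Set R) := (isCompact_range hfc).isClosed
  have hsingle : ∀ (x : F) (m : M), WittVector.teichmuller p x • (m : R) ∈ f.range := by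
    intro x m
    refine ⟨Pi.single x m, ?_⟩
    change ∑ y, _ = _
    rw [Finset.sum_eq_single x]
    · simp
    · intro y _ hy; simp [hy]
    · simp
  have hst : ∀ (x : F), ∀ n ∈ f.range, WittVector.teichmuller p x • n ∈ f.range := by
    rintro x n ⟨m, rfl⟩
    change _ • ∑ y, _ ∈ _
    rw [Finset.smul_sum]
    refine sum_mem fun y _ => ?_
    rw [← mul_smul, ← map_mul]
    exact hsingle _ _
  let N : Submodule (WittVector p F) R :=
    { f.range with smul_mem' := fun w n hn => witt_smul_mem_of_isClosed p hpR hcl hst w hn }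
  have hN : Submodule.span (WittVector p F) (M : Set R) = N := by
    refine le_antisymm (Submodule.span_le.2 fun m hm => ?_) ?_
    · have := hsingle 1 ⟨m, hm⟩
      rwa [map_one, one_smul] at this
    · rintro _ ⟨m, rfl⟩
      exact sum_mem fun x _ => Submodule.smul_mem _ _ (Submodule.subset_span (m x).2)
  rw [hN]
  exact hcl

end WittModule

/-! ### Topology of a compact local ring and of its matrices. -/

section LocalTopology

open IsLocalRing

variable {A : Type*} [CommRing A] [TopologicalSpace A] [IsTopologicalRing A] [CompactSpace A]
  [T2Space A] [IsLocalRing A]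

variable (A) in
theorem isOpen_maximalIdeal_of_compact : IsOpen (maximalIdeal A : Set A) := by
  have h : IsCompact {x : A × A | x.1 * x.2 = 1} :=
    (isClosed_singleton.preimage continuous_mul).isCompact
  have h2 := (h.image continuous_fst).isClosed.isOpen_compl
  convert h2 using 1
  ext a
  simp only [SetLike.mem_coe, mem_maximalIdeal, mem_nonunits_iff, isUnit_iff_exists_inv,
    Set.mem_compl_iff, Set.mem_image, Set.mem_ofPred_eq, Prod.exists, exists_and_right,
    exists_eq_right]

variable (A) in
theorem isClosed_maximalIdeal_of_compact : IsClosed (maximalIdeal A : Set A) :=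
  AddSubgroup.isClosed_of_isOpen (maximalIdeal A).toAddSubgroup (isOpen_maximalIdeal_of_compact A)

theorem isTopNil_of_mem_maximalIdeal {x : A} (hx : x ∈ maximalIdeal A) : IsTopNil x := by
  refine isTopNil_of_idempotent
    (S := { carrier := maximalIdeal A, mul_mem' := fun {a b} _ hb => Ideal.mul_mem_left _ a hb })
    (isClosed_maximalIdeal_of_compact A) (fun e he hee => ?_) hx
  have hu : IsUnit (1 - e) := by
    by_contra h
    have h1 : (1 - e) + e ∈ maximalIdeal A := (maximalIdeal A).add_mem h he
    rw [sub_add_cancel] at h1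
    exact (Ideal.ne_top_iff_one _).1 (maximalIdeal.isMaximal A).ne_top h1
  have : (1 - e) * e = 0 := by rw [sub_mul, hee]; ring
  exact hu.mul_right_eq_zero.1 this

instance compactSpace_matrix {m n : Type*} : CompactSpace (Matrix m n A) :=
  inferInstanceAs (CompactSpace (m → n → A))

theorem isTopNil_matrix {x : Matrix (Fin 2) (Fin 2) A} (hx : ∀ i j, x i j ∈ maximalIdeal A) :
    IsTopNil x := by
  refine isTopNil_of_idempotent
    (S := { carrier := {y : Matrix (Fin 2) (Fin 2) A | ∀ i j, y i j ∈ maximalIdeal A},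
            mul_mem' := fun {a b} _ hb i j => by
              rw [Matrix.mul_apply]
              exact sum_mem fun k _ => Ideal.mul_mem_left _ _ (hb k j) })
    ?_ (fun e he hee => ?_) hx
  · have : {y : Matrix (Fin 2) (Fin 2) A | ∀ i j, y i j ∈ maximalIdeal A} =
        ⋂ i, ⋂ j, (fun y : Matrix (Fin 2) (Fin 2) A => y i j) ⁻¹' maximalIdeal A := by
      ext y; simp
    change IsClosed {y : Matrix (Fin 2) (Fin 2) A | ∀ i j, y i j ∈ maximalIdeal A}
    rw [this]
    exact isClosed_iInter fun i => isClosed_iInter fun j =>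
      (isClosed_maximalIdeal_of_compact A).preimage (by fun_prop)
  · have hu : IsUnit (1 - e) := by
      rw [Matrix.isUnit_iff_isUnit_det, Matrix.det_fin_two]
      by_contra h
      refine (Ideal.ne_top_iff_one _).1 (maximalIdeal.isMaximal A).ne_top ?_
      have h2 : (1 - e) 0 0 * (1 - e) 1 1 - (1 - e) 0 1 * (1 - e) 1 0 ∈ maximalIdeal A := h
      -- The determinant of `1 - e` is `1` modulo `𝔪`.
      have : (1 : A) = ((1 - e) 0 0 * (1 - e) 1 1 - (1 - e) 0 1 * (1 - e) 1 0) +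
          ((1 - e 1 1) * e 0 0 + e 1 1 + e 0 1 * e 1 0) := by simp; ring
      rw [this]
      exact add_mem h2 (add_mem (add_mem (Ideal.mul_mem_left _ _ (he 0 0)) (he 1 1))
        (Ideal.mul_mem_left _ _ (he 1 0)))
    have : (1 - e) * e = 0 := by rw [sub_mul, hee]; simp
    exact hu.mul_right_eq_zero.1 this

theorem isTopNil_natCast_matrix {n : ℕ} (hn : (n : A) ∈ maximalIdeal A) :
    IsTopNil (n : Matrix (Fin 2) (Fin 2) A) := by
  refine isTopNil_matrix fun i j => ?_
  rw [Matrix.natCast_apply]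
  split_ifs
  · exact hn
  · simp

end LocalTopology

end

/-! ### From bracket relations between modules to the ideal `𝔪B`. -/

section IdealStructure

open IsLocalRing

variable {A : Type*} [CommRing A] [TopologicalSpace A] [IsTopologicalRing A] [CompactSpace A]
  [T2Space A]

/-- The product is a finite sum of compact sets `I x`, with `x` running over generators of `B`. -/
theorem isClosed_mul_of_fg {I B : Ideal A} (hI : IsClosed (I : Set A)) (hB : B.FG) :
    IsClosed ((I * B : Ideal A) : Set A) := by
  suffices h : IsCompact ((I * B : Ideal A) : Set A) from h.isClosed
  induction B, hB using Submodule.fg_induction with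
  | singleton x =>
    have : ((I * Submodule.span A {x} : Ideal A) : Set A) = (fun a => a * x) '' I := by
      ext y
      constructor
      · intro hy
        obtain ⟨z, hz, h⟩ := Ideal.mem_mul_span_singleton.1 hy
        exact ⟨z, hz, h⟩
      · rintro ⟨z, hz, h⟩
        exact Ideal.mem_mul_span_singleton.2 ⟨z, hz, h⟩
    rw [this]
    exact hI.isCompact.image (continuous_mul_const x)
  | sup M N hM hN h1 h2 =>
    have : I * (M ⊔ N) = I * M ⊔ I * N := Ideal.mul_sup I M N
    rw [this, Submodule.coe_sup]
    exact h1.add h2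

variable (p : ℕ) [Fact p.Prime] {F : Type*} [Field F] [CharP F p] [Finite F]
  [Algebra (WittVector p F) A]

theorem isClosed_witt_sup {J K : Submodule (WittVector p F) A} (hJ : IsClosed (J : Set A))
    (hK : IsClosed (K : Set A)) : IsClosed ((J ⊔ K : Submodule _ A) : Set A) := by
  rw [Submodule.coe_sup]
  exact (hJ.isCompact.add hK.isCompact).isClosed

theorem isClosed_setOf_forall_mul_mem (X : Set A) {Y : Set A} (hY : IsClosed Y) :
    IsClosed {c : A | ∀ a ∈ X, a * c ∈ Y} := by
  have : {c : A | ∀ a ∈ X, a * c ∈ Y} = ⋂ a ∈ X, (fun c => a * c) ⁻¹' Y := by ext; simp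
  rw [this]
  exact isClosed_biInter fun a _ => hY.preimage (continuous_const_mul a)

/-- The elements `c` with `X c ⊆ Y`. -/
def wittColon (X Y : Submodule (WittVector p F) A) : Submodule (WittVector p F) A where
  carrier := {c : A | ∀ a ∈ X, a * c ∈ Y}
  add_mem' h1 h2 a ha := by rw [mul_add]; exact add_mem (h1 a ha) (h2 a ha)
  zero_mem' a _ := by simp
  smul_mem' w c hc a ha := by rw [mul_smul_comm]; exact Y.smul_mem w (hc a ha)

variable {I₁ B₁ J₀ K : Submodule (WittVector p F) A}

/-- Here `I₁`, `B₁` stand for the diagonal and off-diagonal parts of the span of `L`, and `J₀`, `K`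
for those of `L₂`. The multipliers of `J₀ ⊔ K` form a closed subalgebra containing `I₁` and `B₁`,
hence all of `A`. -/
theorem exists_ideal_eq_sup
    (hIB : I₁ * B₁ ≤ K) (hBB : B₁ * B₁ ≤ J₀) (hKB : K ≤ B₁) (hJI : J₀ ≤ I₁)
    (hJc : IsClosed (J₀ : Set A)) (hKc : IsClosed (K : Set A))
    (hJmin : ∀ Y : Submodule (WittVector p F) A, IsClosed (Y : Set A) → B₁ * B₁ ≤ Y → J₀ ≤ Y)
    (hgen : ∀ S : Subalgebra (WittVector p F) A, IsClosed (S : Set A) → (∀ a ∈ I₁, a ∈ S) →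
      (∀ b ∈ B₁, b ∈ S) → S = ⊤) :
    ∃ J : Ideal A, (J : Set A) = (J₀ ⊔ K : Submodule (WittVector p F) A) := by
  have hcl := isClosed_witt_sup p hJc hKc
  -- On products this is `I₁B₁B₁ ⊆ K B₁ ⊆ B₁B₁ ⊆ J₀`. Minimality of `J₀` among closed submodules
  -- extends it to all of `J₀`.
  have hIJ : J₀ ≤ wittColon p I₁ J₀ := by
    refine hJmin _ (isClosed_setOf_forall_mul_mem _ hJc) (Submodule.mul_le.2 ?_)
    intro b hb b' hb' a ha
    rw [← mul_assoc]
    exact hBB (Submodule.mul_mem_mul (hKB (hIB (Submodule.mul_mem_mul ha hb))) hb')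
  have hBJ : J₀ ≤ wittColon p B₁ K := by
    refine hJmin _ (isClosed_setOf_forall_mul_mem _ hKc) (Submodule.mul_le.2 ?_)
    intro b hb b' hb' a ha
    rw [mul_comm]
    exact hIB (Submodule.mul_mem_mul (hJI (hBB (Submodule.mul_mem_mul hb hb'))) ha)
  let S : Subalgebra (WittVector p F) A :=
    { carrier := {a | ∀ j ∈ J₀ ⊔ K, a * j ∈ J₀ ⊔ K}
      mul_mem' := fun {a b} ha hb j hj => by rw [mul_assoc]; exact ha _ (hb _ hj)
      add_mem' := fun {a b} ha hb j hj => by rw [add_mul]; exact add_mem (ha _ hj) (hb _ hj)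
      algebraMap_mem' := fun w j hj => by
        rw [← Algebra.smul_def]; exact Submodule.smul_mem _ w hj }
  have hS : S = ⊤ := by
    apply hgen
    · have := isClosed_setOf_forall_mul_mem (J₀ ⊔ K : Submodule (WittVector p F) A) hcl
      convert this using 2
      ext a
      change (∀ j ∈ J₀ ⊔ K, a * j ∈ J₀ ⊔ K) ↔ ∀ j ∈ J₀ ⊔ K, j * a ∈ J₀ ⊔ K
      simp_rw [mul_comm a]
    · intro a ha j hj
      obtain ⟨x, hx, y, hy, rfl⟩ := Submodule.mem_sup.1 hj
      rw [mul_add]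
      exact add_mem (Submodule.mem_sup_left (hIJ hx a ha))
        (Submodule.mem_sup_right (hIB (Submodule.mul_mem_mul ha (hKB hy))))
    · intro b hb j hj
      obtain ⟨x, hx, y, hy, rfl⟩ := Submodule.mem_sup.1 hj
      rw [mul_add]
      exact add_mem (Submodule.mem_sup_right (hBJ hx b hb))
        (Submodule.mem_sup_left (hBB (Submodule.mul_mem_mul hb (hKB hy))))
  refine ⟨{ carrier := (J₀ ⊔ K : Submodule (WittVector p F) A)
            add_mem' := add_mem
            zero_mem' := zero_mem _
            smul_mem' := fun a j hj => ?_ }, rfl⟩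
  have ha : a ∈ S := hS ▸ Algebra.mem_top
  exact ha j hj

/-- The elements congruent to a Witt constant modulo `p` and `N` form a closed subalgebra containing
`N`, hence everything. Modulo `p` a constant is a Teichmüller lift, and the only one lying in `𝔪` is
`0`. -/
theorem maximalIdeal_le_sup_of_generates [IsLocalRing A]
    {N : Ideal A} (hN : IsClosed (N : Set A))
    (hgen : ∀ S : Subalgebra (WittVector p F) A, IsClosed (S : Set A) → (∀ a ∈ N, a ∈ S) → S = ⊤) :
    maximalIdeal A ≤ Ideal.span {(p : A)} ⊔ N := by
  set Q := Ideal.span {(p : A)} ⊔ N with hQ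
  have hQc : IsClosed (Q : Set A) := by
    rw [hQ, Submodule.coe_sup]
    exact ((Ideal.isCompact_of_fg ⟨{(p : A)}, by simp⟩).add hN.isCompact).isClosed
  have hpQ : (p : A) ∈ Q := Ideal.mem_sup_left (Ideal.subset_span rfl)
  have hwitt : ∀ w : WittVector p F, algebraMap _ A w - teich p F A (w.coeff 0) ∈ Q := by
    intro w
    obtain ⟨u, hu⟩ := exists_eq_add_p_mul p w (WittVector.teichmuller p (w.coeff 0))
      (by rw [WittVector.teichmuller_coeff_zero])
    have : algebraMap _ A w = teich p F A (w.coeff 0) + p * algebraMap _ A u := by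
      conv_lhs => rw [hu]
      rw [map_add, map_mul, map_natCast, teich]
    rw [this, add_sub_cancel_left]
    exact Ideal.mul_mem_right _ _ hpQ
  let S : Subalgebra (WittVector p F) A :=
    { carrier := {a | ∃ w : WittVector p F, a - algebraMap _ A w ∈ Q}
      mul_mem' := by
        rintro a b ⟨v, hv⟩ ⟨w, hw⟩
        refine ⟨v * w, ?_⟩
        have : a * b - algebraMap _ A (v * w) =
          a * (b - algebraMap _ A w) + algebraMap _ A w * (a - algebraMap _ A v) := by
          rw [map_mul]; ring
        rw [this]
        exact add_mem (Ideal.mul_mem_left _ _ hw) (Ideal.mul_mem_left _ _ hv)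
      add_mem' := by
        rintro a b ⟨v, hv⟩ ⟨w, hw⟩
        refine ⟨v + w, ?_⟩
        rw [map_add, add_sub_add_comm]
        exact add_mem hv hw
      algebraMap_mem' := fun w => ⟨w, by simp⟩ }
  have hSmem : ∀ a, a ∈ S ↔ ∃ x : F, a - teich p F A x ∈ Q := by
    intro a
    constructor
    · rintro ⟨w, hw⟩
      exact ⟨w.coeff 0, by simpa using add_mem hw (hwitt w)⟩
    · rintro ⟨x, hx⟩
      exact ⟨_, hx⟩
  have hS : S = ⊤ := by
    apply hgen
    -- Teichmüller representatives make `S` a finite union of translates of `Q`, hence closed.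
    · have : (S : Set A) = ⋃ x : F, (fun a => a - teich p F A x) ⁻¹' Q := by
        ext a; simpa using hSmem a
      rw [this]
      exact isClosed_iUnion_of_finite fun x => hQc.preimage (by fun_prop)
    · exact fun a ha => ⟨0, by simpa using Ideal.mem_sup_right ha⟩
  intro a ha
  by_cases hQt : Q = ⊤
  · rw [hQt]; trivial
  · have haS : a ∈ S := hS ▸ Algebra.mem_top
    obtain ⟨x, hx⟩ := (hSmem a).1 haS
    have h0 : teich p F A x ∈ maximalIdeal A := by
      simpa using sub_mem ha (le_maximalIdeal hQt hx)
    rw [(teich_mem_maximalIdeal p).1 h0, teich_zero, sub_zero] at hx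
    exact hx

theorem sup_sup_p_mul_eq [IsLocalRing A] (hA : ResidueFieldIs p F A)
    (hIB : I₁ * B₁ ≤ K) (hBB : B₁ * B₁ ≤ J₀) (hKB : K ≤ B₁) (hJI : J₀ ≤ I₁)
    (hJc : IsClosed (J₀ : Set A)) (hKc : IsClosed (K : Set A))
    (hJmin : ∀ Y : Submodule (WittVector p F) A, IsClosed (Y : Set A) → B₁ * B₁ ≤ Y → J₀ ≤ Y)
    (hKmin : ∀ Y : Submodule (WittVector p F) A, IsClosed (Y : Set A) → I₁ * B₁ ≤ Y → K ≤ Y)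
    (hIm : ∀ a ∈ I₁, a ∈ maximalIdeal A) (hBm : ∀ b ∈ B₁, b ∈ maximalIdeal A)
    (hgen : ∀ S : Subalgebra (WittVector p F) A, IsClosed (S : Set A) → (∀ a ∈ I₁, a ∈ S) →
      (∀ b ∈ B₁, b ∈ S) → S = ⊤)
    {B : Ideal A} (hB : B = Ideal.span B₁) (hfg : B.FG) :
    J₀ ⊔ K ⊔ (Ideal.span {(p : A)} * B).restrictScalars (WittVector p F) =
      (maximalIdeal A * B).restrictScalars (WittVector p F) := by
  obtain ⟨J, hJ⟩ := exists_ideal_eq_sup p hIB hBB hKB hJI hJc hKc hJmin hgen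
  have hJ' : J.restrictScalars (WittVector p F) = J₀ ⊔ K := SetLike.coe_injective hJ
  have hBB1 : ∀ b ∈ B₁, b ∈ B := fun b hb => hB ▸ Ideal.subset_span hb
  apply le_antisymm
  · have hmB : IsClosed (((maximalIdeal A * B).restrictScalars (WittVector p F) :
        Submodule _ A) : Set A) :=
      isClosed_mul_of_fg (isClosed_maximalIdeal_of_compact A) hfg
    refine sup_le (sup_le (hJmin _ hmB (Submodule.mul_le.2 fun b hb b' hb' => ?_))
      (hKmin _ hmB (Submodule.mul_le.2 fun b hb b' hb' => ?_))) ?_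
    · exact Ideal.mul_mem_mul (hBm b hb) (hBB1 _ hb')
    · exact Ideal.mul_mem_mul (hIm b hb) (hBB1 _ hb')
    · exact Ideal.mul_mono_left ((Ideal.span_singleton_le_iff_mem _).2
        (natCast_p_mem_maximalIdeal p hA))
  · rw [← hJ']
    -- The multipliers of `B₁` into `J`. This ideal contains `I₁` and `B₁`, so it generates `A`, and
    -- `𝔪 ⊆ pA + N` gives `𝔪B ⊆ pB + J`.
    let N : Ideal A :=
      { carrier := {a | ∀ b ∈ B₁, b * a ∈ J}
        add_mem' := fun h1 h2 a ha => by rw [mul_add]; exact add_mem (h1 a ha) (h2 a ha)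
        zero_mem' := fun a _ => by simp
        smul_mem' := fun c x hx b hb => by
          rw [smul_eq_mul, mul_left_comm]; exact Ideal.mul_mem_left _ _ (hx b hb) }
    have hJcl : IsClosed (J : Set A) := hJ ▸ isClosed_witt_sup p hJc hKc
    have hmem : ∀ {x : A}, x ∈ J₀ ⊔ K → x ∈ J := fun {x} hx => by
      rw [← hJ'] at hx; exact hx
    have hm := maximalIdeal_le_sup_of_generates p (N := N)
      (isClosed_setOf_forall_mul_mem _ hJcl) (fun S hS h => hgen S hS
        (fun a ha => h a fun b hb => hmem (Submodule.mem_sup_right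
          (hIB (mul_comm b a ▸ Submodule.mul_mem_mul ha hb))))
        (fun b' hb' => h b' fun b hb => hmem (Submodule.mem_sup_left
          (hBB (Submodule.mul_mem_mul hb hb')))))
    have : maximalIdeal A * B ≤ J ⊔ Ideal.span {(p : A)} * B := by
      refine Ideal.mul_le.2 fun a ha b hb => ?_
      have hb' : b ∈ Ideal.span (B₁ : Set A) := hB ▸ hb
      induction hb' using Submodule.span_induction generalizing a with
      | mem x hx =>
        obtain ⟨y, hy, n, hn, rfl⟩ := Submodule.mem_sup.1 (hm ha)
        rw [add_mul, add_comm]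
        refine add_mem (Ideal.mem_sup_left ?_) (Ideal.mem_sup_right (Ideal.mul_mem_mul hy hb))
        rw [mul_comm]
        exact hn x hx
      | zero => simp
      | add x y hx hy h1 h2 =>
        rw [mul_add]
        exact add_mem (h1 a ha (hB ▸ hx)) (h2 a ha (hB ▸ hy))
      | smul c x hx h1 =>
        rw [smul_eq_mul, ← mul_assoc]
        exact h1 _ (Ideal.mul_mem_right _ _ ha) (hB ▸ hx)
    intro x hx
    have := this hx
    obtain ⟨y, hy, z, hz, rfl⟩ := Submodule.mem_sup.1 this
    exact add_mem (Submodule.mem_sup_left (S := J.restrictScalars (WittVector p F)) hy)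
      (Submodule.mem_sup_right
        (T := (Ideal.span {(p : A)} * B).restrictScalars (WittVector p F)) hz)

end IdealStructure

/-! ### Independence of the essential submodule from the representation. -/

section Conjugation

open IsLocalRing Matrix

variable {A : Type*} [CommRing A]

theorem linearMap_matrix_apply (φ : Matrix (Fin 2) (Fin 2) A →ₗ[A] Matrix (Fin 2) (Fin 2) A)
    (x : Matrix (Fin 2) (Fin 2) A) : φ x = ∑ i, ∑ j, x i j • φ (single i j 1) := by
  conv_lhs => rw [matrix_eq_sum_single x]
  simp only [map_sum]
  refine Finset.sum_congr rfl fun i _ => Finset.sum_congr rfl fun j _ => ?_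
  rw [← map_smul, smul_single, smul_eq_mul, mul_one]

theorem continuous_linearMap_matrix [TopologicalSpace A] [IsTopologicalRing A]
    (φ : Matrix (Fin 2) (Fin 2) A →ₗ[A] Matrix (Fin 2) (Fin 2) A) : Continuous φ := by
  have : (φ : Matrix (Fin 2) (Fin 2) A → _) =
      fun x => ∑ i, ∑ j, x i j • φ (single i j 1) := funext (linearMap_matrix_apply φ)
  rw [this]
  fun_prop

theorem eq_of_forall_trace_mul_eq {x y : Matrix (Fin 2) (Fin 2) A}
    (h : ∀ z, (x * z).trace = (y * z).trace) : x = y :=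
  Matrix.ext_iff_trace_mul_right.2 h

variable {P : Type*} [Group P] {t : P → A} {d : P →* Aˣ} {ρ ρ' : P →* GL (Fin 2) A}

/-- The linear extension of a representation to the group algebra. -/
noncomputable def groupAlgebraHom (ρ : P →* GL (Fin 2) A) :
    MonoidAlgebra A P →ₐ[A] Matrix (Fin 2) (Fin 2) A :=
  MonoidAlgebra.lift A _ P ((Units.coeHom _).comp ρ)

theorem groupAlgebraHom_of (g : P) :
    groupAlgebraHom ρ (MonoidAlgebra.of A P g) = (ρ g).val := by
  simp [groupAlgebraHom]

theorem IsTDRep.surjective (hρ : IsTDRep t d ρ) : Function.Surjective (groupAlgebraHom ρ) := by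
  have : Submodule.span A (Set.range fun g => (ρ g).val) ≤
      LinearMap.range (groupAlgebraHom ρ).toLinearMap := by
    rw [Submodule.span_le]
    rintro _ ⟨g, rfl⟩
    exact ⟨MonoidAlgebra.of A P g, groupAlgebraHom_of g⟩
  rw [hρ.span_eq] at this
  intro x
  exact this (Submodule.mem_top (x := x))

theorem IsTDRep.trace_groupAlgebraHom (hρ : IsTDRep t d ρ) (hρ' : IsTDRep t d ρ')
    (x : MonoidAlgebra A P) : (groupAlgebraHom ρ x).trace = (groupAlgebraHom ρ' x).trace := by
  induction x using MonoidAlgebra.induction_on with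
  | of g => rw [groupAlgebraHom_of, groupAlgebraHom_of, hρ.trace_eq, hρ'.trace_eq]
  | add x y hx hy => rw [map_add, map_add, trace_add, trace_add, hx, hy]
  | smul a x hx => rw [map_smul, map_smul, trace_smul, trace_smul, hx]

/-- The trace form on `M₂(A)` is nondegenerate, so an element of `A[P]` dies under a surjective
representation exactly when its products all have trace zero, a condition on `t` alone. -/
theorem IsTDRep.ker_le (hρ : IsTDRep t d ρ) (hρ' : IsTDRep t d ρ') :
    RingHom.ker (groupAlgebraHom ρ) ≤ RingHom.ker (groupAlgebraHom ρ') := by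
  intro x hx
  rw [RingHom.mem_ker] at hx ⊢
  refine eq_of_forall_trace_mul_eq fun z => ?_
  obtain ⟨y, rfl⟩ := hρ'.surjective z
  rw [← map_mul, ← hρ.trace_groupAlgebraHom hρ', map_mul, hx]
  simp

/-- `M₂(A)` is the quotient of `A[P]` by the kernel of `ρ`, through which `ρ'` factors. This `φ`
need not be exhibited as a conjugation: `A`-linearity and invariance of the trace suffice to
transport `Γ`, `L` and `L₂`. -/
theorem IsTDRep.exists_algHom (hρ : IsTDRep t d ρ) (hρ' : IsTDRep t d ρ') :
    ∃ φ : Matrix (Fin 2) (Fin 2) A →ₐ[A] Matrix (Fin 2) (Fin 2) A,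
      (∀ g, φ (ρ g).val = (ρ' g).val) ∧ ∀ x, (φ x).trace = x.trace := by
  let φ := (Ideal.Quotient.liftₐ (RingHom.ker (groupAlgebraHom ρ)) (groupAlgebraHom ρ')
    (hρ.ker_le hρ')).comp
    (Ideal.quotientKerAlgEquivOfSurjective hρ.surjective).symm.toAlgHom
  have hφ : ∀ x, φ (groupAlgebraHom ρ x) = groupAlgebraHom ρ' x := by
    intro x
    have : (Ideal.quotientKerAlgEquivOfSurjective hρ.surjective).symm (groupAlgebraHom ρ x) =
        Ideal.Quotient.mk _ x := by
      rw [AlgEquiv.symm_apply_eq]; rfl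
    change Ideal.Quotient.liftₐ (RingHom.ker (groupAlgebraHom ρ)) (groupAlgebraHom ρ')
      (hρ.ker_le hρ')
      ((Ideal.quotientKerAlgEquivOfSurjective hρ.surjective).symm (groupAlgebraHom ρ x)) = _
    rw [this]
    rfl
  refine ⟨φ, fun g => ?_, fun x => ?_⟩
  · rw [← groupAlgebraHom_of, hφ, groupAlgebraHom_of]
  · obtain ⟨y, rfl⟩ := hρ.surjective x
    rw [hφ, hρ.trace_groupAlgebraHom hρ']

variable [IsLocalRing A] {φ : Matrix (Fin 2) (Fin 2) A →ₐ[A] Matrix (Fin 2) (Fin 2) A}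

theorem IsTDRep.map_pinkGamma (hρ : IsTDRep t d ρ) (hρ' : IsTDRep t d ρ')
    (hφ : ∀ g, φ (ρ g).val = (ρ' g).val) {x : Matrix (Fin 2) (Fin 2) A} (hx : x ∈ pinkGamma ρ) :
    φ x ∈ pinkGamma ρ' := by
  obtain ⟨⟨g, rfl⟩, hdet, hm⟩ := hx
  refine ⟨⟨g, (hφ g).symm⟩, ?_, fun i j => ?_⟩
  · have h1 := congrArg Units.val ((hρ.det_eq g).trans (hρ'.det_eq g).symm)
    rw [hφ, ← hdet]
    exact h1.symm
  · rw [← map_one φ, ← map_sub]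
    have := linearMap_matrix_apply φ.toLinearMap ((ρ g).val - 1)
    rw [AlgHom.toLinearMap_apply] at this
    rw [this, Matrix.sum_apply]
    refine sum_mem fun k _ => ?_
    rw [Matrix.sum_apply]
    exact sum_mem fun l _ => Ideal.mul_mem_right _ _ (hm k l)

theorem map_pinkTheta (htr : ∀ x, (φ x).trace = x.trace) (x : Matrix (Fin 2) (Fin 2) A) :
    φ (pinkTheta x) = pinkTheta (φ x) := by
  rw [pinkTheta, pinkTheta, map_sub, map_smul, map_one, htr]

variable [TopologicalSpace A] [IsTopologicalRing A]

theorem IsTDRep.map_pinkLie (hρ : IsTDRep t d ρ) (hρ' : IsTDRep t d ρ')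
    (hφ : ∀ g, φ (ρ g).val = (ρ' g).val) (htr : ∀ x, (φ x).trace = x.trace) :
    pinkLie ρ ≤ (pinkLie ρ').comap (φ : _ →+ Matrix (Fin 2) (Fin 2) A) := by
  refine AddSubgroup.topologicalClosure_minimal _ ((AddSubgroup.closure_le _).2 ?_)
    ((AddSubgroup.isClosed_topologicalClosure _).preimage
      (continuous_linearMap_matrix φ.toLinearMap))
  rintro _ ⟨x, hx, rfl⟩
  refine AddSubgroup.le_topologicalClosure _ (AddSubgroup.subset_closure ?_)
  exact ⟨φ x, hρ.map_pinkGamma hρ' hφ hx, (map_pinkTheta htr x).symm⟩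

theorem IsTDRep.map_pinkLie₂ (hρ : IsTDRep t d ρ) (hρ' : IsTDRep t d ρ')
    (hφ : ∀ g, φ (ρ g).val = (ρ' g).val) (htr : ∀ x, (φ x).trace = x.trace) :
    pinkLie₂ ρ ≤ (pinkLie₂ ρ').comap (φ : _ →+ Matrix (Fin 2) (Fin 2) A) := by
  refine AddSubgroup.topologicalClosure_minimal _ ((AddSubgroup.closure_le _).2 ?_)
    ((AddSubgroup.isClosed_topologicalClosure _).preimage
      (continuous_linearMap_matrix φ.toLinearMap))
  rintro _ ⟨x, hx, y, hy, rfl⟩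
  refine AddSubgroup.le_topologicalClosure _ (AddSubgroup.subset_closure ?_)
  refine ⟨φ x, hρ.map_pinkLie hρ' hφ htr hx, φ y, hρ.map_pinkLie hρ' hφ htr hy, ?_⟩
  change φ (x * y - y * x) = _
  rw [map_sub, map_mul, map_mul]

variable (p : ℕ) [Fact p.Prime] (F : Type*) [Field F] [Algebra (WittVector p F) A]

theorem IsTDRep.essentialSubmodule_le (hρ : IsTDRep t d ρ) (hρ' : IsTDRep t d ρ') :
    essentialSubmodule p F ρ ≤ essentialSubmodule p F ρ' := by
  obtain ⟨φ, hφ, htr⟩ := hρ.exists_algHom hρ'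
  refine iSup₂_le fun g hg => Submodule.span_le.2 ?_
  obtain ⟨⟨h, rfl⟩, h0, hsq⟩ := hg
  rintro _ ⟨x, hx, rfl⟩
  have hg' : ρ' h ∈ essentialS ρ' := by
    refine ⟨⟨h, rfl⟩, ?_, ?_⟩
    · rw [← hφ, htr, h0]
    · rwa [hρ'.det_eq, ← hρ.det_eq]
  refine le_iSup₂ (f := fun g (_ : g ∈ essentialS ρ') => Submodule.span (WittVector p F)
    {a | ∃ x ∈ pinkLie₂ ρ', a = (g.val * x).trace}) (ρ' h) hg' (Submodule.subset_span ?_)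
  refine ⟨φ x, hρ.map_pinkLie₂ hρ' hφ htr hx, ?_⟩
  rw [← hφ, ← map_mul, htr]

/-- The essential submodule depends only on the pseudo-representation. -/
theorem IsTDRep.essentialSubmodule_eq (hρ : IsTDRep t d ρ) (hρ' : IsTDRep t d ρ') :
    essentialSubmodule p F ρ = essentialSubmodule p F ρ' :=
  le_antisymm (hρ.essentialSubmodule_le p F hρ') (hρ'.essentialSubmodule_le p F hρ)

end Conjugation

section

open Topology Filter

/-! ### Diagonal matrices and the dihedral residual image. -/

section Diagonal

variable {R : Type*} [CommRing R]

theorem gl_inv_apply_offDiag (g : GL (Fin 2) R) :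
    ∃ u : R, (g⁻¹).val 0 1 = u * g.val 0 1 ∧ (g⁻¹).val 1 0 = u * g.val 1 0 := by
  refine ⟨-Ring.inverse g.val.det, ?_⟩
  rw [Matrix.coe_units_inv, Matrix.inv_def, Matrix.adjugate_fin_two]
  simp

/-- The invertible matrices which are diagonal modulo an ideal. -/
def offDiagSubgroup (I : Ideal R) : Subgroup (GL (Fin 2) R) where
  carrier := {g | g.val 0 1 ∈ I ∧ g.val 1 0 ∈ I}
  mul_mem' := by
    rintro a b ⟨ha, ha'⟩ ⟨hb, hb'⟩
    constructor <;> rw [Units.val_mul, Matrix.mul_apply, Fin.sum_univ_two]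
    · exact add_mem (Ideal.mul_mem_left _ _ hb) (Ideal.mul_mem_right _ _ ha)
    · exact add_mem (Ideal.mul_mem_right _ _ ha') (Ideal.mul_mem_left _ _ hb')
  one_mem' := by simp
  inv_mem' := by
    rintro g ⟨h1, h2⟩
    obtain ⟨u, hu, hu'⟩ := gl_inv_apply_offDiag g
    exact ⟨hu ▸ Ideal.mul_mem_left _ _ h1, hu' ▸ Ideal.mul_mem_left _ _ h2⟩

theorem mem_offDiagSubgroup {I : Ideal R} {g : GL (Fin 2) R} :
    g ∈ offDiagSubgroup I ↔ g.val 0 1 ∈ I ∧ g.val 1 0 ∈ I := Iff.rfl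

theorem mem_offDiagSubgroup_bot {g : GL (Fin 2) R} :
    g ∈ offDiagSubgroup (⊥ : Ideal R) ↔ g.val 0 1 = 0 ∧ g.val 1 0 = 0 := by
  simp [mem_offDiagSubgroup]

theorem pow_apply_of_offDiag {g : GL (Fin 2) R} (hg : g ∈ offDiagSubgroup (⊥ : Ideal R))
    (k : ℕ) : (g ^ k).val 0 0 = g.val 0 0 ^ k ∧ (g ^ k).val 1 1 = g.val 1 1 ^ k := by
  induction k with
  | zero => simp
  | succ k ih =>
    obtain ⟨h1, h2⟩ := mem_offDiagSubgroup_bot.1 hg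
    rw [pow_succ, Units.val_mul, Matrix.mul_apply, Matrix.mul_apply, Fin.sum_univ_two,
      Fin.sum_univ_two, h1, h2, ih.1, ih.2]
    simp [pow_succ]

theorem mem_center_of_offDiag {g : GL (Fin 2) R} (hg : g ∈ offDiagSubgroup (⊥ : Ideal R)) :
    g ∈ Subgroup.center (GL (Fin 2) R) ↔ g.val 0 0 = g.val 1 1 := by
  obtain ⟨h1, h2⟩ := mem_offDiagSubgroup_bot.1 hg
  rw [Matrix.GeneralLinearGroup.mem_center_iff_val_mem_range_scalar]
  constructor
  · rintro ⟨a, ha⟩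
    rw [← ha]; simp
  · intro h
    refine ⟨g.val 0 0, ?_⟩
    ext i j
    fin_cases i <;> fin_cases j <;> simp [h, h1, h2]

end Diagonal

section Residual

open Matrix.ProjGenLinGroup

variable {F P : Type*} [Field F] [Group P] {r : P →* GL (Fin 2) F} {g₀ : P}

theorem diagSubgroup_le_range : diagSubgroup r g₀ ≤ r.range :=
  (Subgroup.closure_le _).2 (Set.union_subset (by rintro _ rfl; exact ⟨g₀, rfl⟩)
    fun _ hx => hx.1)

theorem diagSubgroup_le_offDiagSubgroup (h01 : (r g₀).val 0 1 = 0) (h10 : (r g₀).val 1 0 = 0) :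
    diagSubgroup r g₀ ≤ offDiagSubgroup (⊥ : Ideal F) := by
  refine (Subgroup.closure_le _).2 (Set.union_subset ?_ ?_)
  · rintro _ rfl
    exact mem_offDiagSubgroup_bot.2 ⟨h01, h10⟩
  · rintro x ⟨-, c, hc⟩
    refine mem_offDiagSubgroup_bot.2 ?_
    rw [hc]; simp

theorem map_mk_diagSubgroup :
    (diagSubgroup r g₀).map mk = Subgroup.zpowers (mk (r g₀)) := by
  apply le_antisymm
  · rw [Subgroup.map_le_iff_le_comap]
    refine (Subgroup.closure_le _).2 (Set.union_subset ?_ ?_)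
    · rintro _ rfl
      exact Subgroup.mem_zpowers _
    · rintro x ⟨-, c, hc⟩
      have : mk x = 1 := by
        rw [mk_eq_one, Matrix.GeneralLinearGroup.mem_center_iff_val_mem_range_scalar]
        exact ⟨c, hc.symm⟩
      rw [SetLike.mem_coe, Subgroup.mem_comap, this]
      exact one_mem _
  · rw [Subgroup.zpowers_le]
    exact ⟨_, Subgroup.subset_closure (Or.inl rfl), rfl⟩

/-- `D` contains all scalars of the residual image, so it is saturated for the projection to `PGL₂`,
and its index survives there. -/
theorem mk_mem_map_diagSubgroup {x : GL (Fin 2) F} (hx : x ∈ r.range) :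
    mk x ∈ (diagSubgroup r g₀).map mk ↔ x ∈ diagSubgroup r g₀ := by
  refine ⟨?_, fun h => ⟨x, h, rfl⟩⟩
  rintro ⟨y, hy, hyx⟩
  have h1 : y⁻¹ * x ∈ diagSubgroup r g₀ := by
    refine Subgroup.subset_closure (Or.inr ⟨mul_mem (inv_mem (diagSubgroup_le_range hy)) hx, ?_⟩)
    have : mk (y⁻¹ * x) = 1 := by rw [map_mul, map_inv, hyx, inv_mul_cancel]
    rw [mk_eq_one, Matrix.GeneralLinearGroup.mem_center_iff_val_mem_range_scalar] at this
    obtain ⟨c, hc⟩ := this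
    exact ⟨c, hc.symm⟩
  simpa using mul_mem hy h1

theorem orderOf_mk_mul_two (hidx : (diagSubgroup r g₀).relIndex r.range = 2) :
    orderOf (mk (r g₀)) * 2 = Nat.card (projImage r) := by
  have h : (Subgroup.zpowers (mk (r g₀))).relIndex (projImage r) = 2 := by
    obtain ⟨a, ha, hab⟩ := Subgroup.relIndex_eq_two_iff.1 hidx
    obtain ⟨a', rfl⟩ := ha
    rw [Subgroup.relIndex_eq_two_iff]
    refine ⟨mk (r a'), ⟨a', rfl⟩, ?_⟩
    rintro _ ⟨b, rfl⟩
    have := hab (r b) ⟨b, rfl⟩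
    rw [MonoidHom.comp_apply, ← map_mul, ← map_mk_diagSubgroup,
      mk_mem_map_diagSubgroup (mul_mem ⟨b, rfl⟩ ⟨a', rfl⟩), mk_mem_map_diagSubgroup ⟨b, rfl⟩]
    exact this
  have hle : Subgroup.zpowers (mk (r g₀)) ≤ projImage r := by
    rw [Subgroup.zpowers_le]; exact ⟨g₀, rfl⟩
  have := Subgroup.relIndex_mul_relIndex ⊥ _ _ bot_le hle
  rwa [Subgroup.relIndex_bot_left, Subgroup.relIndex_bot_left, Nat.card_zpowers, h] at this

/-- The cyclic part of the projective image contains an element of order `2`, and its generator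
has order at least `4`. -/
theorem exists_trace_zero_diagonal (hidx : (diagSubgroup r g₀).relIndex r.range = 2)
    (h01 : (r g₀).val 0 1 = 0) (h10 : (r g₀).val 1 0 = 0) {n : ℕ}
    (hcard : Nat.card (projImage r) = n) (hn : 4 < n) (h4 : 4 ∣ n) :
    (r g₀).val 0 0 ^ 2 ≠ (r g₀).val 1 1 ^ 2 ∧
    ∃ h : P, (r h).val 0 1 = 0 ∧ (r h).val 1 0 = 0 ∧ (r h).val 0 0 ≠ 0 ∧
      (r h).val 1 1 = -(r h).val 0 0 := by
  obtain ⟨q, rfl⟩ := h4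
  -- Index `2` makes the order `n / 2 = 2q`, and `n > 4` forces `q ≥ 2`. So the squares of the two
  -- eigenvalues differ.
  have ho : orderOf (mk (r g₀)) = 2 * q := by
    have := orderOf_mk_mul_two hidx
    omega
  have hg : r g₀ ∈ offDiagSubgroup (⊥ : Ideal F) := mem_offDiagSubgroup_bot.2 ⟨h01, h10⟩
  have hpow : ∀ k : ℕ, 2 * q ∣ k ↔ (r g₀).val 0 0 ^ k = (r g₀).val 1 1 ^ k := by
    intro k
    rw [← ho, orderOf_dvd_iff_pow_eq_one, ← map_pow, mk_eq_one,
      mem_center_of_offDiag (pow_mem hg k), (pow_apply_of_offDiag hg k).1,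
      (pow_apply_of_offDiag hg k).2]
  -- The power `q` gives the involution of the cyclic part: its diagonal entries have equal squares
  -- but are distinct, hence opposite.
  refine ⟨fun h => ?_, g₀ ^ q, ?_⟩
  · have := Nat.le_of_dvd (by norm_num) ((hpow 2).2 h)
    omega
  · have h1 := mem_offDiagSubgroup_bot.1 (pow_mem hg q)
    rw [map_pow]
    have hne : (r g₀).val 0 0 ^ q ≠ (r g₀).val 1 1 ^ q := fun h => by
      have := Nat.le_of_dvd (by omega) ((hpow q).2 h)
      omega
    have heq := (hpow (q * 2)).1 ⟨1, by ring⟩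
    have hneg : (r g₀).val 1 1 ^ q = -(r g₀).val 0 0 ^ q := by
      rw [pow_mul, pow_mul, sq_eq_sq_iff_eq_or_eq_neg] at heq
      rcases heq with h | h
      · exact absurd h hne
      · rw [h, neg_neg]
    refine ⟨h1.1, h1.2, ?_, ?_⟩
    · rw [(pow_apply_of_offDiag hg q).1]
      intro h0
      rw [h0, neg_zero] at hneg
      exact hne (h0.trans hneg.symm)
    · rw [(pow_apply_of_offDiag hg q).1, (pow_apply_of_offDiag hg q).2, hneg]

end Residual

/-! ### Maximal pro-`p` quotients. -/

section ProP

variable {p : ℕ} [Fact p.Prime] {H : Type*} [Group H] [TopologicalSpace H] [IsTopologicalGroup H]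
  [CompactSpace H] [TotallyDisconnectedSpace H] {X : Type*} [Monoid X] [TopologicalSpace X]
  [T2Space X]

/-- A continuous homomorphism all of whose values `x` satisfy `x ^ p ^ n → 1` factors through the
largest pro-`p` quotient. -/
theorem proPKernel_le_ker (f : H →* X) (hf : Continuous f)
    (hpow : ∀ h, Tendsto (fun n => f h ^ p ^ n) atTop (𝓝 1)) : proPKernel p H ≤ f.ker := by
  intro h hh
  by_contra hK
  have hKc : IsClosed (f.ker : Set H) := isClosed_singleton.preimage hf
  have hU : IsOpen {n : H | h * n ∉ f.ker} :=
    hKc.isOpen_compl.preimage (continuous_const_mul h)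
  obtain ⟨N, hN⟩ := ProfiniteGrp.exist_openNormalSubgroup_sub_open_nhds_of_one hU
    (by simpa using hK)
  -- `N` is so small that `h` avoids `M`. The image under `f` of the complement of `M` is closed and
  -- misses `1`, so each element has a `p`-power in `M`; then `M` has `p`-power index and must
  -- contain `h`, a contradiction.
  let M : Subgroup H := f.ker ⊔ (N : Subgroup H)
  have hNn : (N : Subgroup H).Normal := N.isNormal'
  have hMo : IsOpen (M : Set H) := Subgroup.isOpen_mono le_sup_right N.isOpen
  have hfin : Finite (H ⧸ M) := Subgroup.quotient_finite_of_isOpen M hMo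
  have hpM : ∀ g : H, ∃ n : ℕ, g ^ p ^ n ∈ M := by
    intro g
    have hcl : IsClosed (f '' (M : Set H)ᶜ) :=
      (hMo.isClosed_compl.isCompact.image hf).isClosed
    have h1 : (1 : X) ∈ (f '' (M : Set H)ᶜ)ᶜ := by
      rintro ⟨x, hx, hx1⟩
      exact hx (Subgroup.mem_sup_left hx1)
    obtain ⟨n, hn⟩ := ((hpow g).eventually (hcl.isOpen_compl.mem_nhds h1)).exists
    refine ⟨n, ?_⟩
    by_contra hg
    exact hn ⟨g ^ p ^ n, hg, map_pow f g _⟩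
  have hPG : IsPGroup p (H ⧸ M) := by
    intro x
    induction x using QuotientGroup.induction_on with
    | H g =>
      obtain ⟨n, hn⟩ := hpM g
      exact ⟨n, by rw [← QuotientGroup.mk_pow, QuotientGroup.eq_one_iff]; exact hn⟩
  obtain ⟨k, hk⟩ := IsPGroup.iff_card.1 hPG
  have hM : h ∈ M := by
    rw [proPKernel, Subgroup.mem_sInf] at hh
    exact hh M ⟨inferInstance, hMo, k, hk⟩
  obtain ⟨x, hx, y, hy, hxy⟩ := Subgroup.mem_sup_of_normal_left.1 hM
  refine hN (inv_mem hy : y⁻¹ ∈ (N : Subgroup H)) ?_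
  rw [← hxy, mul_assoc, mul_inv_cancel, mul_one]
  exact hx

/-- Lift topological generators of the quotient. A closed subgroup containing the kernel is
saturated, so its image is closed and dense. -/
theorem exists_finset_of_topFG (h : TopFG (H ⧸ proPKernel p H)) :
    ∃ s : Finset H, ∀ C : Subgroup H, IsClosed (C : Set H) → proPKernel p H ≤ C →
      (∀ x ∈ s, x ∈ C) → C = ⊤ := by
  classical
  obtain ⟨s, hs⟩ := h
  refine ⟨s.image Quotient.out, fun C hC hpC hsC => ?_⟩
  have hpre : (QuotientGroup.mk ⁻¹' (QuotientGroup.mk '' (C : Set H) : Set (H ⧸ proPKernel p H)))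
      = (C : Set H) := by
    ext x
    constructor
    · rintro ⟨y, hy, hyx⟩
      have := hpC (QuotientGroup.eq.1 hyx)
      simpa using mul_mem hy this
    · exact fun hx => ⟨x, hx, rfl⟩
  have hcl : IsClosed (C.map (QuotientGroup.mk' (proPKernel p H)) : Set (H ⧸ proPKernel p H)) := by
    rw [← QuotientGroup.isOpenQuotientMap_mk.isQuotientMap.isClosed_preimage]
    change IsClosed (QuotientGroup.mk ⁻¹' (QuotientGroup.mk '' (C : Set H)))
    rwa [hpre]
  have hle : Subgroup.closure (s : Set (H ⧸ proPKernel p H)) ≤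
      C.map (QuotientGroup.mk' (proPKernel p H)) := by
    rw [Subgroup.closure_le]
    intro x hx
    exact ⟨Quotient.out x, hsC _ (Finset.mem_image_of_mem _ hx), Quotient.out_eq x⟩
  have htop := (hs.mono hle).closure_eq
  rw [hcl.closure_eq] at htop
  refine eq_top_iff.2 fun x _ => ?_
  have : (QuotientGroup.mk x : H ⧸ proPKernel p H) ∈
      (C.map (QuotientGroup.mk' (proPKernel p H)) : Set (H ⧸ proPKernel p H)) := by
    rw [htop]; trivial
  have h2 : x ∈ (QuotientGroup.mk ⁻¹' (QuotientGroup.mk '' (C : Set H) :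
    Set (H ⧸ proPKernel p H))) := this
  rwa [hpre] at h2

end ProP

end

section

open Topology Filter IsLocalRing

/-! ### Continuity and reduction of well-adapted representations, and the ideal `B`. -/

section Continuity

variable {A P : Type*} [CommRing A] [TopologicalSpace A] [IsTopologicalRing A] [Group P]
  [TopologicalSpace P] [IsTopologicalGroup P] {t : P → A} {d : P →* Aˣ} {ρ : P →* GL (Fin 2) A}

/-- A `(t, d)`-representation is continuous as soon as its trace is. -/
theorem IsTDRep.continuous (hρ : IsTDRep t d ρ) (ht : Continuous t) :
    Continuous fun g => (ρ g).val := by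
  -- Since the image spans, this trace is an `A`-combination of translates `t (g * h)`. Taking
  -- matrix units for `z` gives the entries of `ρ g`.
  have key : ∀ z : Matrix (Fin 2) (Fin 2) A, Continuous fun g => ((ρ g).val * z).trace := by
    intro z
    have hz : z ∈ Submodule.span A (Set.range fun g => (ρ g).val) := by
      rw [hρ.span_eq]; trivial
    induction hz using Submodule.span_induction with
    | mem x hx =>
      obtain ⟨h, rfl⟩ := hx
      have : (fun g => ((ρ g).val * (ρ h).val).trace) = fun g => t (g * h) := by
        funext g
        rw [← hρ.trace_eq, map_mul, Units.val_mul]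
      simp only [this]
      exact ht.comp (continuous_mul_const h)
    | zero => simp only [mul_zero, Matrix.trace_zero]; exact continuous_const
    | add x y _ _ hx hy =>
      simp only [mul_add, Matrix.trace_add]
      exact hx.add hy
    | smul a x _ hx =>
      simp only [Matrix.mul_smul, Matrix.trace_smul, smul_eq_mul]
      exact hx.const_mul a
  refine continuous_matrix fun i j => ?_
  have := key (Matrix.single j i 1)
  simpa [Matrix.trace_mul_single] using this

end Continuity

section Reduction

variable {p : ℕ} [Fact p.Prime] {F : Type*} [Field F] [CharP F p]
  {A : Type*} [CommRing A] [IsLocalRing A] [Algebra (WittVector p F) A]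
  {P : Type*} [Group P] {r : P →* GL (Fin 2) F} {ρ : P →* GL (Fin 2) A} {g₀ : P}

theorem IsWellAdapted.sub_one_mem (hw : IsWellAdapted p r ρ g₀) {k : P} (hk : k ∈ r.ker)
    (i j : Fin 2) : ((ρ k).val - 1) i j ∈ maximalIdeal A := by
  have h := hw.reduction k i j
  rw [MonoidHom.mem_ker.1 hk, ReducesTo] at h
  rw [Matrix.sub_apply]
  by_cases hij : i = j
  · subst hij
    simpa [teich_one] using h
  · simpa [hij, teich_zero] using h

theorem IsWellAdapted.mem_ker (hw : IsWellAdapted p r ρ g₀) {k : P}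
    (hk : ∀ i j, ((ρ k).val - 1) i j ∈ maximalIdeal A) : k ∈ r.ker := by
  rw [MonoidHom.mem_ker]
  refine Units.ext (Matrix.ext fun i j => ?_)
  refine ReducesTo.unique p (hw.reduction k i j) ?_
  have := hk i j
  rw [Matrix.sub_apply] at this
  rw [ReducesTo]
  by_cases hij : i = j
  · subst hij
    simpa [teich_one] using this
  · simpa [hij, teich_zero] using this

theorem IsWellAdapted.eq_map_teich (hw : IsWellAdapted p r ρ g₀)
    (g : P) : ∃ h : P, r h = r g ∧ (ρ h).val = (r g).val.map (teich p F A) := by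
  obtain ⟨h, hh⟩ := hw.teich_mem g
  refine ⟨h, Units.ext (Matrix.ext fun i j => ?_), hh⟩
  have := hw.reduction h i j
  rw [hh] at this
  refine ReducesTo.unique p this ?_
  rw [ReducesTo, Matrix.map_apply, sub_self]
  exact zero_mem _

theorem IsWellAdapted.exists_mul_teich (hw : IsWellAdapted p r ρ g₀)
    (g : P) : ∃ k ∈ r.ker, (ρ g).val = (ρ k).val * (r g).val.map (teich p F A) := by
  obtain ⟨h, hr, hh⟩ := hw.eq_map_teich g
  refine ⟨g * h⁻¹, ?_, ?_⟩
  · rw [MonoidHom.mem_ker, map_mul, map_inv, hr, mul_inv_cancel]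
  · rw [← hh, ← Units.val_mul, ← map_mul, inv_mul_cancel_right]

theorem IsWellAdapted.residual_offDiag (hw : IsWellAdapted p r ρ g₀) :
    (r g₀).val 0 1 = 0 ∧ (r g₀).val 1 0 = 0 := by
  have h0 : ReducesTo p (0 : A) (0 : F) := by
    rw [ReducesTo, teich_zero, sub_zero]; exact zero_mem _
  exact ⟨ReducesTo.unique p (hw.adapted.1 ▸ hw.reduction g₀ 0 1) h0,
    ReducesTo.unique p (hw.adapted.2.1 ▸ hw.reduction g₀ 1 0) h0⟩

/-- The elements of the residual image outside `D` are antidiagonal. -/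
theorem IsWellAdapted.antidiag_of_notMem (hw : IsWellAdapted p r ρ g₀)
    {x : GL (Fin 2) F} (hx : x ∈ r.range)
    (hxD : x ∉ diagSubgroup r g₀) : x.val 0 0 = 0 ∧ x.val 1 1 = 0 := by
  obtain ⟨h01, h10⟩ := hw.residual_offDiag
  have hD := diagSubgroup_le_offDiagSubgroup (r := r) h01 h10
  obtain ⟨h, h0, h1, -⟩ := hw.antidiag
  have hh : r h ∉ diagSubgroup r g₀ := by
    intro hmem
    obtain ⟨h2, h3⟩ := mem_offDiagSubgroup_bot.1 (hD hmem)
    have hdet : IsUnit (r h).val.det := (Matrix.isUnit_iff_isUnit_det _).1 (r h).isUnit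
    rw [Matrix.det_fin_two, h0, h2] at hdet
    simp at hdet
  obtain ⟨a, ha, hab⟩ := Subgroup.relIndex_eq_two_iff.1 hw.index_two
  have hxa : x * a ∈ diagSubgroup r g₀ := (hab x hx).or.resolve_right hxD
  have hha : r h * a ∈ diagSubgroup r g₀ := (hab (r h) ⟨h, rfl⟩).or.resolve_right hh
  -- Both `x` and the antidiagonal `r h` lie in the nontrivial coset of `D`, so they differ by a
  -- diagonal matrix.
  have hm : x * (r h)⁻¹ ∈ diagSubgroup r g₀ := by
    have := mul_mem hxa (inv_mem hha)
    rwa [mul_inv_rev, ← mul_assoc, mul_inv_cancel_right] at this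
  obtain ⟨h2, h3⟩ := mem_offDiagSubgroup_bot.1 (hD hm)
  have hx2 : x.val = (x * (r h)⁻¹).val * (r h).val := by
    rw [← Units.val_mul, inv_mul_cancel_right]
  rw [hx2, Matrix.mul_apply, Matrix.mul_apply, Fin.sum_univ_two, Fin.sum_univ_two, h2, h3, h0, h1]
  simp

theorem IsWellAdapted.offDiagIdeal_eq_span (hw : IsWellAdapted p r ρ g₀) :
    offDiagIdeal r ρ g₀ = Ideal.span ((fun k => (ρ k).val 0 1) '' (r.ker : Set P)) := by
  rw [offDiagIdeal, indexTwoAlgebra, Submodule.map_span, ← Set.image_comp]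
  apply le_antisymm
  · rw [Submodule.span_le]
    rintro _ ⟨g, hg, rfl⟩
    obtain ⟨k, hk, hgk⟩ := hw.exists_mul_teich g
    obtain ⟨h01, h10⟩ := hw.residual_offDiag
    have hD := mem_offDiagSubgroup_bot.1 (diagSubgroup_le_offDiagSubgroup (r := r) h01 h10 hg)
    change (ρ g).val 0 1 ∈ _
    rw [hgk, Matrix.mul_apply, Fin.sum_univ_two, Matrix.map_apply, hD.1, teich_zero, mul_zero,
      zero_add]
    exact Ideal.mul_mem_right _ _ (Ideal.subset_span ⟨k, hk, rfl⟩)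
  · rw [Ideal.span, Submodule.span_le]
    rintro _ ⟨k, hk, rfl⟩
    refine Submodule.subset_span ⟨k, ?_, rfl⟩
    rw [SetLike.mem_coe, Subgroup.mem_comap, MonoidHom.mem_ker.1 hk]
    exact one_mem _

variable [TopologicalSpace A]

/-- A Teichmüller value is determined by its residue. Consequently the condition `det = 1` in `Γ` is
automatic, and `Γ` is the image of the kernel of `r`. -/
theorem IsAdmissible.d_eq_one [TopologicalSpace P] {t : P → A} {d : P →* Aˣ}
    (hadm : IsAdmissible p r t d) {k : P} (hk : k ∈ r.ker) :
    d k = 1 := by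
  obtain ⟨x, hx⟩ := hadm.d_constant k
  have h1 := hadm.d_reduces k
  rw [MonoidHom.mem_ker.1 hk] at h1
  have h2 : ReducesTo p (d k : A) x := by
    rw [ReducesTo, hx, sub_self]; exact zero_mem _
  have := ReducesTo.unique p h2 h1
  refine Units.ext ?_
  rw [hx, this]
  simp [teich_one]

theorem IsWellAdapted.mem_pinkGamma_iff [TopologicalSpace P] {t : P → A} {d : P →* Aˣ}
    (hw : IsWellAdapted p r ρ g₀) (hadm : IsAdmissible p r t d)
    (hρ : IsTDRep t d ρ) {x : Matrix (Fin 2) (Fin 2) A} :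
    x ∈ pinkGamma ρ ↔ ∃ k ∈ r.ker, (ρ k).val = x := by
  constructor
  · rintro ⟨⟨k, rfl⟩, -, hm⟩
    exact ⟨k, hw.mem_ker hm, rfl⟩
  · rintro ⟨k, hk, rfl⟩
    refine ⟨⟨k, rfl⟩, ?_, hw.sub_one_mem hk⟩
    have := congrArg Units.val ((hρ.det_eq k).trans (hadm.d_eq_one hk))
    exact this

variable [IsTopologicalRing A] [CompactSpace A] [T2Space A]

theorem IsWellAdapted.tendsto_pow (hw : IsWellAdapted p r ρ g₀) (hA : ResidueFieldIs p F A) {k : P}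
    (hk : k ∈ r.ker) : Tendsto (fun n => (ρ k).val ^ p ^ n) atTop (𝓝 1) := by
  have := tendsto_one_add_pow (Fact.out : p.Prime) (isTopNil_matrix (hw.sub_one_mem hk))
    (isTopNil_natCast_matrix (natCast_p_mem_maximalIdeal p hA))
  simpa using this

/-- On the open subgroup `r.ker`, `ρ` factors through the topologically finitely generated pro-`p`
quotient. Being diagonal modulo the closed ideal spanned by the off-diagonal entries of finitely
many generators is a closed subgroup condition, so it holds on all of `r.ker`. -/
theorem IsWellAdapted.offDiagIdeal_fg [TopologicalSpace P] [IsTopologicalGroup P] [CompactSpace P]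
    [TotallyDisconnectedSpace P] {t : P → A} {d : P →* Aˣ}
    (hw : IsWellAdapted p r ρ g₀) (hA : ResidueFieldIs p F A) (hadm : IsAdmissible p r t d)
    (hρ : IsTDRep t d ρ) : (offDiagIdeal r ρ g₀).FG := by
  classical
  have hcont := hρ.continuous hadm.t_continuous
  have hcl : IsClosed (r.ker : Set P) := Subgroup.isClosed_of_isOpen _ hadm.rep_continuous
  have : CompactSpace r.ker := isCompact_iff_compactSpace.1 hcl.isCompact
  let f : r.ker →* Matrix (Fin 2) (Fin 2) A := ((Units.coeHom _).comp ρ).comp r.ker.subtype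
  have hf : Continuous f := hcont.comp continuous_subtype_val
  have hker : proPKernel p r.ker ≤ f.ker :=
    proPKernel_le_ker f hf fun h => hw.tendsto_pow hA h.2
  obtain ⟨s, hs⟩ := exists_finset_of_topFG (hadm.pFinite r.ker hadm.rep_continuous)
  let T : Finset A := s.image (fun k => f k 0 1) ∪ s.image (fun k => f k 1 0)
  let B' : Ideal A := Ideal.span T
  have hB'cl : IsClosed (B' : Set A) := (Ideal.isCompact_of_fg ⟨T, rfl⟩).isClosed
  have htop := hs ((offDiagSubgroup B').comap (ρ.comp r.ker.subtype)) ?_ ?_ ?_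
  · have hmem : ∀ k ∈ r.ker, (ρ k).val 0 1 ∈ B' := by
      intro k hk
      have : (⟨k, hk⟩ : r.ker) ∈ (offDiagSubgroup B').comap (ρ.comp r.ker.subtype) :=
        htop ▸ Subgroup.mem_top _
      exact this.1
    have h01 : ∀ k ∈ r.ker, (ρ k).val 0 1 ∈ offDiagIdeal r ρ g₀ := by
      intro k hk
      rw [hw.offDiagIdeal_eq_span]
      exact Ideal.subset_span ⟨k, hk, rfl⟩
    -- Conjugation by an antidiagonal Teichmüller lift exchanges the two corners up to units.
    have h10 : ∀ k ∈ r.ker, (ρ k).val 1 0 ∈ offDiagIdeal r ρ g₀ := by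
      intro k hk
      obtain ⟨h, h0, h1, -⟩ := hw.antidiag
      obtain ⟨h', -, hh'⟩ := hw.eq_map_teich h
      have hdet : IsUnit (r h).val.det := (Matrix.isUnit_iff_isUnit_det _).1 (r h).isUnit
      rw [Matrix.det_fin_two, h0, zero_mul, zero_sub] at hdet
      have hne : (r h).val 0 1 ≠ 0 := fun h => by simp [h] at hdet
      have hconj : h' * k * h'⁻¹ ∈ r.ker := r.normal_ker.conj_mem k hk h'
      have heq : (ρ (h' * k * h'⁻¹)).val * (ρ h').val = (ρ h').val * (ρ k).val := by
        rw [← Units.val_mul, ← map_mul, ← Units.val_mul, ← map_mul, inv_mul_cancel_right]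
      have h00 := congrFun (congrFun heq 0) 0
      rw [Matrix.mul_apply, Matrix.mul_apply, Fin.sum_univ_two, Fin.sum_univ_two, hh',
        Matrix.map_apply, Matrix.map_apply, Matrix.map_apply, h0, teich_zero, mul_zero, zero_add,
        zero_mul, zero_add] at h00
      have hm := Ideal.mul_mem_right (teich p F A ((r h).val 1 0)) _ (h01 _ hconj)
      rw [h00] at hm
      exact (Ideal.unit_mul_mem_iff_mem _ (isUnit_teich p hne)).1 hm
    refine ⟨T, le_antisymm ?_ ?_⟩
    · rw [Submodule.span_le]
      intro x hx
      simp only [T, Finset.coe_union, Finset.coe_image] at hx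
      rcases hx with ⟨k, -, rfl⟩ | ⟨k, -, rfl⟩
      · exact h01 _ k.2
      · exact h10 _ k.2
    · rw [hw.offDiagIdeal_eq_span, Ideal.span, Submodule.span_le]
      rintro _ ⟨k, hk, rfl⟩
      exact hmem k hk
  · have : ((offDiagSubgroup B').comap (ρ.comp r.ker.subtype) : Set r.ker) =
        (fun k => f k 0 1) ⁻¹' B' ∩ (fun k => f k 1 0) ⁻¹' B' := rfl
    rw [this]
    exact (hB'cl.preimage (hf.matrix_elem 0 1)).inter (hB'cl.preimage (hf.matrix_elem 1 0))
  · intro k hk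
    have h1 : (ρ k).val = 1 := hker hk
    change ρ k ∈ offDiagSubgroup B'
    rw [mem_offDiagSubgroup, h1]
    simp
  · intro k hk
    refine ⟨Ideal.subset_span ?_, Ideal.subset_span ?_⟩
    · exact Finset.mem_coe.2 (Finset.mem_union_left _ (Finset.mem_image_of_mem _ hk))
    · exact Finset.mem_coe.2 (Finset.mem_union_right _ (Finset.mem_image_of_mem _ hk))

end Reduction

end

section

open Topology Filter IsLocalRing

/-! ### Pink's Lie algebra, its derived algebra and their `W(F)`-spans. -/

section Bracket

variable {A : Type*} [CommRing A]

/-- The additive map `x ↦ x y - y x`. -/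
def bracketHom (y : Matrix (Fin 2) (Fin 2) A) :
    Matrix (Fin 2) (Fin 2) A →+ Matrix (Fin 2) (Fin 2) A :=
  AddMonoidHom.mulRight y - AddMonoidHom.mulLeft y

variable [TopologicalSpace A] [IsTopologicalRing A]

theorem bracket_mem_of_closure {S : Set (Matrix (Fin 2) (Fin 2) A)}
    {Y : AddSubgroup (Matrix (Fin 2) (Fin 2) A)}
    (hY : IsClosed (Y : Set (Matrix (Fin 2) (Fin 2) A)))
    (h : ∀ x ∈ S, ∀ y ∈ S, x * y - y * x ∈ Y) {x y : Matrix (Fin 2) (Fin 2) A}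
    (hx : x ∈ (AddSubgroup.closure S).topologicalClosure)
    (hy : y ∈ (AddSubgroup.closure S).topologicalClosure) : x * y - y * x ∈ Y := by
  have hc : ∀ y : Matrix (Fin 2) (Fin 2) A, Continuous (bracketHom y) := fun y => by
    have : (bracketHom y : _ → Matrix (Fin 2) (Fin 2) A) = fun x => x * y - y * x := rfl
    rw [this]; fun_prop
  have key : ∀ (y : Matrix (Fin 2) (Fin 2) A), (∀ x ∈ S, x * y - y * x ∈ Y) →
      (AddSubgroup.closure S).topologicalClosure ≤ Y.comap (bracketHom y) := fun y hy =>
    AddSubgroup.topologicalClosure_minimal _ ((AddSubgroup.closure_le _).2 hy)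
      (hY.preimage (hc y))
  refine key y (fun x hx => ?_) hx
  have := key x (fun y hy => ?_) hy
  · rw [← neg_sub]
    exact neg_mem this
  · exact h y hy x hx

variable {P : Type*} [Group P] [IsLocalRing A] {ρ : P →* GL (Fin 2) A}

/-- The closed additive subgroup generated by `Θ(Γ)` is a Lie subring: on `Γ` one has
`[Θ(x), Θ(y)] = Θ(xy) - Θ(yx)`. -/
theorem bracket_mem_pinkLie
    (hmul : ∀ x ∈ pinkGamma ρ, ∀ y ∈ pinkGamma ρ, x * y ∈ pinkGamma ρ)
    {x y : Matrix (Fin 2) (Fin 2) A} (hx : x ∈ pinkLie ρ) (hy : y ∈ pinkLie ρ) :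
    x * y - y * x ∈ pinkLie ρ := by
  refine bracket_mem_of_closure (AddSubgroup.isClosed_topologicalClosure _) ?_ hx hy
  rintro _ ⟨γ, hγ, rfl⟩ _ ⟨δ, hδ, rfl⟩
  have : pinkTheta γ * pinkTheta δ - pinkTheta δ * pinkTheta γ =
      pinkTheta (γ * δ) - pinkTheta (δ * γ) := by
    simp only [pinkTheta, Matrix.trace_mul_comm δ γ]
    simp only [sub_mul, mul_sub, smul_mul_assoc, mul_smul_comm, mul_one, one_mul]
    module
  rw [this]
  exact sub_mem (AddSubgroup.le_topologicalClosure _ (AddSubgroup.subset_closure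
      ⟨_, hmul _ hγ _ hδ, rfl⟩))
    (AddSubgroup.le_topologicalClosure _ (AddSubgroup.subset_closure ⟨_, hmul _ hδ _ hγ, rfl⟩))

end Bracket

section WittLie

variable (p : ℕ) [Fact p.Prime] (F : Type*) [Field F]
  {A : Type*} [CommRing A] [Algebra (WittVector p F) A]
  [TopologicalSpace A] [IsTopologicalRing A] {P : Type*} [Group P] [IsLocalRing A]
  (ρ : P →* GL (Fin 2) A)

/-- The `W(F)`-span of Pink's Lie algebra. -/
noncomputable def wittLie : Submodule (WittVector p F) (Matrix (Fin 2) (Fin 2) A) :=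
  Submodule.span _ (pinkLie ρ : Set (Matrix (Fin 2) (Fin 2) A))

/-- The `W(F)`-span of the derived Lie algebra. -/
noncomputable def wittLie₂ : Submodule (WittVector p F) (Matrix (Fin 2) (Fin 2) A) :=
  Submodule.span _ (pinkLie₂ ρ : Set (Matrix (Fin 2) (Fin 2) A))

variable {p F ρ}

theorem wittLie_le {Y : Submodule (WittVector p F) (Matrix (Fin 2) (Fin 2) A)}
    (hY : IsClosed (Y : Set (Matrix (Fin 2) (Fin 2) A)))
    (h : ∀ γ ∈ pinkGamma ρ, pinkTheta γ ∈ Y) : wittLie p F ρ ≤ Y := by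
  refine Submodule.span_le.2 ?_
  exact AddSubgroup.topologicalClosure_minimal (t := Y.toAddSubgroup) _
    ((AddSubgroup.closure_le _).2 (by rintro _ ⟨γ, hγ, rfl⟩; exact h γ hγ)) hY

theorem wittLie₂_le {Y : Submodule (WittVector p F) (Matrix (Fin 2) (Fin 2) A)}
    (hY : IsClosed (Y : Set (Matrix (Fin 2) (Fin 2) A)))
    (h : ∀ x ∈ wittLie p F ρ, ∀ y ∈ wittLie p F ρ, x * y - y * x ∈ Y) : wittLie₂ p F ρ ≤ Y := by
  refine Submodule.span_le.2 ?_
  refine AddSubgroup.topologicalClosure_minimal (t := Y.toAddSubgroup) _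
    ((AddSubgroup.closure_le _).2 ?_) hY
  rintro _ ⟨x, hx, y, hy, rfl⟩
  exact h x (Submodule.subset_span hx) y (Submodule.subset_span hy)

theorem pinkTheta_mem_wittLie {γ : Matrix (Fin 2) (Fin 2) A} (hγ : γ ∈ pinkGamma ρ) :
    pinkTheta γ ∈ wittLie p F ρ :=
  Submodule.subset_span (AddSubgroup.le_topologicalClosure _
    (AddSubgroup.subset_closure ⟨γ, hγ, rfl⟩))

theorem bracket_mem_wittLie₂ {x y : Matrix (Fin 2) (Fin 2) A} (hx : x ∈ wittLie p F ρ)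
    (hy : y ∈ wittLie p F ρ) : x * y - y * x ∈ wittLie₂ p F ρ := by
  induction hx, hy using Submodule.span_induction₂ with
  | mem_mem x y hx hy =>
    exact Submodule.subset_span (AddSubgroup.le_topologicalClosure _
      (AddSubgroup.subset_closure ⟨x, hx, y, hy, rfl⟩))
  | zero_left y hy => simp
  | zero_right x hx => simp
  | add_left x y z _ _ _ h1 h2 =>
    have : (x + y) * z - z * (x + y) = (x * z - z * x) + (y * z - z * y) := by noncomm_ring
    rw [this]; exact add_mem h1 h2
  | add_right x y z _ _ _ h1 h2 =>
    have : x * (y + z) - (y + z) * x = (x * y - y * x) + (x * z - z * x) := by noncomm_ring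
    rw [this]; exact add_mem h1 h2
  | smul_left w x y _ _ h =>
    rw [smul_mul_assoc, mul_smul_comm, ← smul_sub]; exact Submodule.smul_mem _ _ h
  | smul_right w x y _ _ h =>
    rw [smul_mul_assoc, mul_smul_comm, ← smul_sub]; exact Submodule.smul_mem _ _ h

theorem wittLie₂_le_wittLie
    (hmul : ∀ x ∈ pinkGamma ρ, ∀ y ∈ pinkGamma ρ, x * y ∈ pinkGamma ρ) :
    wittLie₂ p F ρ ≤ wittLie p F ρ := by
  refine Submodule.span_mono ?_
  refine AddSubgroup.topologicalClosure_minimal (t := pinkLie ρ) _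
    ((AddSubgroup.closure_le _).2 ?_) (AddSubgroup.isClosed_topologicalClosure _)
  rintro _ ⟨x, hx, y, hy, rfl⟩
  exact bracket_mem_pinkLie hmul hx hy

theorem isClosed_wittLie [CompactSpace A] [T2Space A] [Finite F] [CharP F p]
    (hA : ResidueFieldIs p F A) :
    IsClosed (wittLie p F ρ : Set (Matrix (Fin 2) (Fin 2) A)) :=
  isClosed_witt_span p (isTopNil_natCast_matrix (natCast_p_mem_maximalIdeal p hA))
    (AddSubgroup.isClosed_topologicalClosure _)

theorem isClosed_wittLie₂ [CompactSpace A] [T2Space A] [Finite F] [CharP F p]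
    (hA : ResidueFieldIs p F A) :
    IsClosed (wittLie₂ p F ρ : Set (Matrix (Fin 2) (Fin 2) A)) :=
  isClosed_witt_span p (isTopNil_natCast_matrix (natCast_p_mem_maximalIdeal p hA))
    (AddSubgroup.isClosed_topologicalClosure _)

/-- Conjugation by `g`, as a `W(F)`-linear map. -/
def conjLinear (g : GL (Fin 2) A) :
    Matrix (Fin 2) (Fin 2) A →ₗ[WittVector p F] Matrix (Fin 2) (Fin 2) A where
  toFun x := g.val * x * (g⁻¹).val
  map_add' x y := by rw [mul_add, add_mul]
  map_smul' w x := by rw [mul_smul_comm, smul_mul_assoc]; rfl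

theorem continuous_conjLinear (g : GL (Fin 2) A) :
    Continuous (conjLinear (p := p) (F := F) g) := by
  have : (conjLinear (p := p) (F := F) g : _ → _) = fun x => g.val * x * (g⁻¹).val := rfl
  rw [this]; fun_prop

theorem conjLinear_mul (g : GL (Fin 2) A) (x y : Matrix (Fin 2) (Fin 2) A) :
    conjLinear (p := p) (F := F) g (x * y) =
      conjLinear (p := p) (F := F) g x * conjLinear (p := p) (F := F) g y := by
  change g.val * (x * y) * (g⁻¹).val = g.val * x * (g⁻¹).val * (g.val * y * (g⁻¹).val)
  have h : (g⁻¹).val * g.val = 1 := by rw [← Units.val_mul, inv_mul_cancel, Units.val_one]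
  calc _ = g.val * x * 1 * y * (g⁻¹).val := by noncomm_ring
    _ = _ := by rw [← h]; noncomm_ring

theorem pinkTheta_conj (g : GL (Fin 2) A) (x : Matrix (Fin 2) (Fin 2) A) :
    pinkTheta (conjLinear (p := p) (F := F) g x) =
      conjLinear (p := p) (F := F) g (pinkTheta x) := by
  have h : g.val * (g⁻¹).val = 1 := by rw [← Units.val_mul, mul_inv_cancel, Units.val_one]
  have h' : (g⁻¹).val * g.val = 1 := by rw [← Units.val_mul, inv_mul_cancel, Units.val_one]
  change g.val * x * (g⁻¹).val - _ = g.val * (x - _) * (g⁻¹).val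
  have ht : (conjLinear (p := p) (F := F) g x).trace = x.trace := by
    change (g.val * x * (g⁻¹).val).trace = _
    rw [Matrix.trace_mul_comm, ← mul_assoc, h', one_mul]
  rw [ht, mul_sub, sub_mul, mul_smul_comm, smul_mul_assoc, mul_one, h]

theorem conj_mem_wittLie [CompactSpace A] [T2Space A] [Finite F] [CharP F p]
    (hA : ResidueFieldIs p F A) {g : GL (Fin 2) A}
    (hg : ∀ γ ∈ pinkGamma ρ, conjLinear (p := p) (F := F) g γ ∈ pinkGamma ρ)
    {x : Matrix (Fin 2) (Fin 2) A} (hx : x ∈ wittLie p F ρ) :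
    conjLinear (p := p) (F := F) g x ∈ wittLie p F ρ := by
  have : wittLie p F ρ ≤ (wittLie p F ρ).comap (conjLinear g) :=
    wittLie_le ((isClosed_wittLie hA).preimage (continuous_conjLinear g)) fun γ hγ => by
      rw [Submodule.mem_comap, ← pinkTheta_conj]
      exact pinkTheta_mem_wittLie (hg γ hγ)
  exact this hx

theorem conj_mem_wittLie₂ [CompactSpace A] [T2Space A] [Finite F] [CharP F p]
    (hA : ResidueFieldIs p F A) {g : GL (Fin 2) A}
    (hg : ∀ γ ∈ pinkGamma ρ, conjLinear (p := p) (F := F) g γ ∈ pinkGamma ρ)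
    {x : Matrix (Fin 2) (Fin 2) A} (hx : x ∈ wittLie₂ p F ρ) :
    conjLinear (p := p) (F := F) g x ∈ wittLie₂ p F ρ := by
  have : wittLie₂ p F ρ ≤ (wittLie₂ p F ρ).comap (conjLinear g) :=
    wittLie₂_le ((isClosed_wittLie₂ hA).preimage (continuous_conjLinear g)) fun x hx y hy => by
      rw [Submodule.mem_comap, map_sub, conjLinear_mul, conjLinear_mul]
      exact bracket_mem_wittLie₂ (conj_mem_wittLie hA hg hx) (conj_mem_wittLie hA hg hy)
  exact this hx

end WittLie

/-! ### Weight decomposition of torus-stable modules. -/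

section Decomposition

variable {W A : Type*} [CommRing W] [CommRing A] [Algebra W A]

variable (W A) in
/-- `a ↦ diag(a, -a)`. -/
def diagEmb : A →ₗ[W] Matrix (Fin 2) (Fin 2) A where
  toFun a := !![a, 0; 0, -a]
  map_add' a b := by ext i j; fin_cases i <;> fin_cases j <;> simp [add_comm]
  map_smul' w a := by ext i j; fin_cases i <;> fin_cases j <;> simp

variable (W A) in
/-- The strictly upper triangular matrices. -/
def upperEmb : A →ₗ[W] Matrix (Fin 2) (Fin 2) A where
  toFun b := !![0, b; 0, 0]
  map_add' a b := by ext i j; fin_cases i <;> fin_cases j <;> simp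
  map_smul' w a := by ext i j; fin_cases i <;> fin_cases j <;> simp

theorem diagEmb_apply (a : A) : diagEmb W A a = !![a, 0; 0, -a] := rfl

theorem upperEmb_apply (b : A) : upperEmb W A b = !![0, b; 0, 0] := rfl

theorem continuous_diagEmb [TopologicalSpace A] [IsTopologicalRing A] :
    Continuous (diagEmb W A) := by
  refine continuous_matrix fun i j => ?_
  fin_cases i <;> fin_cases j <;> simp [diagEmb_apply] <;> fun_prop

theorem continuous_upperEmb [TopologicalSpace A] [IsTopologicalRing A] :
    Continuous (upperEmb W A) := by
  refine continuous_matrix fun i j => ?_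
  fin_cases i <;> fin_cases j <;> simp [upperEmb_apply] <;> fun_prop

/-- A submodule of trace zero matrices stable under conjugation by a diagonal matrix of ratio `z`
and by an antidiagonal matrix of ratio `u`. -/
structure IsTorusStable (X : Submodule W (Matrix (Fin 2) (Fin 2) A)) : Prop where
  trace_zero : ∀ x ∈ X, x 1 1 = -x 0 0
  diag : ∃ z z' : W, z * z' = 1 ∧ IsUnit (z - 1) ∧ IsUnit (z - z') ∧
    ∀ x ∈ X, !![x 0 0, z • x 0 1; z' • x 1 0, x 1 1] ∈ X
  antidiag : ∃ u u' : W, u * u' = 1 ∧ ∀ x ∈ X, !![x 1 1, u • x 1 0; u' • x 0 1, x 0 0] ∈ X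

theorem mem_of_isUnit_smul_mem {M : Type*} [AddCommGroup M] [Module W M] {X : Submodule W M}
    {w : W} (hw : IsUnit w) {x : M} (h : w • x ∈ X) : x ∈ X := by
  obtain ⟨u, rfl⟩ := hw
  have := X.smul_mem (↑u⁻¹ : W) h
  rwa [← mul_smul, Units.inv_mul, one_smul] at this

namespace IsTorusStable

variable {X : Submodule W (Matrix (Fin 2) (Fin 2) A)}

/-- With `T` the diagonal conjugation, `(T - z')(T - 1)` kills the weights `1` and `z'` and
multiplies the weight `z` by the unit `(z - z')(z - 1)`. -/
theorem upper (hX : IsTorusStable X) {x : Matrix (Fin 2) (Fin 2) A} (hx : x ∈ X) :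
    upperEmb W A (x 0 1) ∈ X := by
  obtain ⟨z, z', hz, h1, h2, hd⟩ := hX.diag
  refine mem_of_isUnit_smul_mem (h1.mul h2) ?_
  have hy : !![0, (z - 1) • x 0 1; (z' - 1) • x 1 0, 0] ∈ X := by
    convert sub_mem (hd x hx) hx using 1
    ext i j
    fin_cases i <;> fin_cases j <;> simp [sub_smul]
  convert sub_mem (hd _ hy) (X.smul_mem z' hy) using 1
  ext i j
  fin_cases i <;> fin_cases j <;> simp [upperEmb_apply]
  module

theorem lower (hX : IsTorusStable X) {x : Matrix (Fin 2) (Fin 2) A} (hx : x ∈ X) :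
    upperEmb W A (x 1 0) ∈ X := by
  obtain ⟨u, u', hu, hw⟩ := hX.antidiag
  have := hX.upper (hw x hx)
  have h2 : upperEmb W A (u • x 1 0) ∈ X := this
  rw [map_smul] at h2
  exact mem_of_isUnit_smul_mem (IsUnit.of_mul_eq_one _ hu) h2

theorem lower_mem (hX : IsTorusStable X) {b : A} (hb : upperEmb W A b ∈ X) :
    (!![0, 0; b, 0] : Matrix (Fin 2) (Fin 2) A) ∈ X := by
  obtain ⟨u, u', hu, hw⟩ := hX.antidiag
  refine mem_of_isUnit_smul_mem (w := u') (IsUnit.of_mul_eq_one u (by rw [mul_comm, hu])) ?_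
  convert hw _ hb using 1
  ext i j
  fin_cases i <;> fin_cases j <;> simp [upperEmb_apply]

theorem diagonal (hX : IsTorusStable X) {x : Matrix (Fin 2) (Fin 2) A} (hx : x ∈ X) :
    diagEmb W A (x 0 0) ∈ X := by
  have := sub_mem (sub_mem hx (hX.upper hx)) (hX.lower_mem (hX.lower hx))
  convert this using 1
  ext i j
  fin_cases i <;> fin_cases j <;> simp [upperEmb_apply, diagEmb_apply, hX.trace_zero x hx]

end IsTorusStable

end Decomposition

end

section

open Topology Filter IsLocalRing

/-! ### Torus stability of conjugation-stable modules and entries of the Lie algebra. -/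

section WellAdaptedLie

variable {p : ℕ} [Fact p.Prime] {F : Type*} [Field F] [CharP F p]
  {A : Type*} [CommRing A] [IsLocalRing A] [Algebra (WittVector p F) A] [TopologicalSpace A]
  {P : Type*} [Group P] {r : P →* GL (Fin 2) F} {ρ : P →* GL (Fin 2) A} {g₀ : P}

theorem smul_eq_teich_mul (x : F) (a : A) :
    WittVector.teichmuller p x • a = teich p F A x * a := Algebra.smul_def _ _

section Gamma

variable [TopologicalSpace P] {t : P → A} {d : P →* Aˣ}

theorem IsWellAdapted.mul_mem_pinkGamma (hw : IsWellAdapted p r ρ g₀)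
    (hadm : IsAdmissible p r t d) (hρ : IsTDRep t d ρ) {x y : Matrix (Fin 2) (Fin 2) A}
    (hx : x ∈ pinkGamma ρ) (hy : y ∈ pinkGamma ρ) : x * y ∈ pinkGamma ρ := by
  obtain ⟨k, hk, rfl⟩ := (hw.mem_pinkGamma_iff hadm hρ).1 hx
  obtain ⟨l, hl, rfl⟩ := (hw.mem_pinkGamma_iff hadm hρ).1 hy
  exact (hw.mem_pinkGamma_iff hadm hρ).2 ⟨k * l, mul_mem hk hl, by rw [map_mul, Units.val_mul]⟩

theorem IsWellAdapted.conj_mem_pinkGamma (hw : IsWellAdapted p r ρ g₀)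
    (hadm : IsAdmissible p r t d) (hρ : IsTDRep t d ρ) (h : P) {x : Matrix (Fin 2) (Fin 2) A}
    (hx : x ∈ pinkGamma ρ) : conjLinear (p := p) (F := F) (ρ h) x ∈ pinkGamma ρ := by
  obtain ⟨k, hk, rfl⟩ := (hw.mem_pinkGamma_iff hadm hρ).1 hx
  refine (hw.mem_pinkGamma_iff hadm hρ).2 ⟨h * k * h⁻¹, r.normal_ker.conj_mem k hk h, ?_⟩
  rw [map_mul, map_mul, map_inv, Units.val_mul, Units.val_mul]
  rfl

end Gamma

theorem mem_of_mul_eq {X : Submodule (WittVector p F) (Matrix (Fin 2) (Fin 2) A)}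
    {g : GL (Fin 2) A} {x y : Matrix (Fin 2) (Fin 2) A}
    (hx : conjLinear (p := p) (F := F) g x ∈ X) (h : y * g.val = g.val * x) : y ∈ X := by
  have hy : conjLinear (p := p) (F := F) g x = y := by
    change g.val * x * (g⁻¹).val = y
    rw [← h, mul_assoc, ← Units.val_mul, mul_inv_cancel, Units.val_one, mul_one]
  exact hy ▸ hx

/-- Stability under conjugation by the image of `ρ` gives stability under the Teichmüller lifts of
`r g₀` and of an antidiagonal matrix. -/
theorem IsWellAdapted.isTorusStable (hw : IsWellAdapted p r ρ g₀)
    (hne : (r g₀).val 0 0 ^ 2 ≠ (r g₀).val 1 1 ^ 2)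
    {X : Submodule (WittVector p F) (Matrix (Fin 2) (Fin 2) A)}
    (htr : ∀ x ∈ X, x 1 1 = -x 0 0)
    (hconj : ∀ h, ∀ x ∈ X, conjLinear (p := p) (F := F) (ρ h) x ∈ X) : IsTorusStable X := by
  refine ⟨htr, ?_, ?_⟩
  · obtain ⟨h01, h10⟩ := hw.residual_offDiag
    obtain ⟨h, -, hh⟩ := hw.eq_map_teich g₀
    have hdet : IsUnit (r g₀).val.det := (Matrix.isUnit_iff_isUnit_det _).1 (r g₀).isUnit
    rw [Matrix.det_fin_two, h01, zero_mul, sub_zero] at hdet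
    have ha : (r g₀).val 0 0 ≠ 0 := fun h => by simp [h] at hdet
    have hb : (r g₀).val 1 1 ≠ 0 := fun h => by simp [h] at hdet
    -- For the eigenvalue ratio `z`, both `z ≠ 1` and `z ≠ z⁻¹` follow from `hne`, and differences
    -- of lifts of distinct elements are units.
    refine ⟨WittVector.teichmuller p ((r g₀).val 0 0 / (r g₀).val 1 1),
      WittVector.teichmuller p ((r g₀).val 1 1 / (r g₀).val 0 0), ?_, ?_, ?_, fun x hx => ?_⟩
    · rw [← map_mul, div_mul_div_cancel₀ hb, div_self ha, map_one]
    · rw [← map_one (WittVector.teichmuller p)]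
      refine isUnit_teichmuller_sub p fun h => hne ?_
      rw [(div_eq_one_iff_eq hb).1 h]
    · refine isUnit_teichmuller_sub p fun h => hne ?_
      rw [div_eq_div_iff hb ha] at h
      rw [sq, sq, h]
    · have h1 : teich p F A ((r g₀).val 0 0 / (r g₀).val 1 1) * teich p F A ((r g₀).val 1 1) =
          teich p F A ((r g₀).val 0 0) := by rw [← teich_mul, div_mul_cancel₀ _ hb]
      have h2 : teich p F A ((r g₀).val 1 1 / (r g₀).val 0 0) * teich p F A ((r g₀).val 0 0) =
          teich p F A ((r g₀).val 1 1) := by rw [← teich_mul, div_mul_cancel₀ _ ha]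
      refine mem_of_mul_eq (hconj h x hx) ?_
      · rw [hh]
        ext i j
        fin_cases i <;> fin_cases j <;>
          simp [Matrix.mul_apply, Fin.sum_univ_two, h01, h10, teich_zero, smul_eq_teich_mul]
        · ring
        · linear_combination x 0 1 * h1
        · linear_combination x 1 0 * h2
        · ring
  · obtain ⟨g, h00, h11, -⟩ := hw.antidiag
    obtain ⟨h, -, hh⟩ := hw.eq_map_teich g
    have hdet : IsUnit (r g).val.det := (Matrix.isUnit_iff_isUnit_det _).1 (r g).isUnit
    rw [Matrix.det_fin_two, h00, zero_mul, zero_sub] at hdet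
    have hb : (r g).val 0 1 ≠ 0 := fun h => by simp [h] at hdet
    have hc : (r g).val 1 0 ≠ 0 := fun h => by simp [h] at hdet
    refine ⟨WittVector.teichmuller p ((r g).val 0 1 / (r g).val 1 0),
      WittVector.teichmuller p ((r g).val 1 0 / (r g).val 0 1), ?_, fun x hx => ?_⟩
    · rw [← map_mul, div_mul_div_cancel₀ hc, div_self hb, map_one]
    · have h1 : teich p F A ((r g).val 0 1 / (r g).val 1 0) * teich p F A ((r g).val 1 0) =
          teich p F A ((r g).val 0 1) := by rw [← teich_mul, div_mul_cancel₀ _ hc]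
      have h2 : teich p F A ((r g).val 1 0 / (r g).val 0 1) * teich p F A ((r g).val 0 1) =
          teich p F A ((r g).val 1 0) := by rw [← teich_mul, div_mul_cancel₀ _ hb]
      refine mem_of_mul_eq (hconj h x hx) ?_
      · rw [hh]
        ext i j
        fin_cases i <;> fin_cases j <;>
          simp [Matrix.mul_apply, Fin.sum_univ_two, h00, h11, teich_zero, smul_eq_teich_mul]
        · linear_combination x 1 0 * h1
        · ring
        · ring
        · linear_combination x 0 1 * h2

theorem trace_mem_wittLie [IsTopologicalRing A] [T2Space A] (hp : p ≠ 2)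
    {x : Matrix (Fin 2) (Fin 2) A} (hx : x ∈ wittLie p F ρ) : x 1 1 = -x 0 0 := by
  have h2 : IsUnit (2 : A) := isUnit_two_algebra p (F := F) hp
  have hle : wittLie p F ρ ≤ LinearMap.ker (Matrix.traceLinearMap (Fin 2) (WittVector p F) A) := by
    refine wittLie_le ?_ fun γ _ => ?_
    · have : IsClosed ((fun x : Matrix (Fin 2) (Fin 2) A => x.trace) ⁻¹' {0}) :=
        isClosed_singleton.preimage (by fun_prop)
      exact this
    · rw [LinearMap.mem_ker, Matrix.traceLinearMap_apply, pinkTheta, Matrix.trace_sub,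
        Matrix.trace_smul, Matrix.trace_one, smul_eq_mul]
      have := Ring.inverse_mul_cancel _ h2
      simp only [Fintype.card_fin, Nat.cast_ofNat]
      linear_combination (-γ.trace) * this
  have := hle hx
  rw [LinearMap.mem_ker, Matrix.traceLinearMap_apply, Matrix.trace_fin_two] at this
  linear_combination this

theorem entry_mem_of_mem_wittLie [IsTopologicalRing A] [T2Space A] [CompactSpace A] (hp : p ≠ 2)
    {x : Matrix (Fin 2) (Fin 2) A} (hx : x ∈ wittLie p F ρ) :
    x 0 0 ∈ maximalIdeal A ∧ x 0 1 ∈ maximalIdeal A := by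
  have h2 : IsUnit (2 : A) := isUnit_two_algebra p (F := F) hp
  have hcl : ∀ i j, IsClosed ((((maximalIdeal A).restrictScalars (WittVector p F)).comap
      (Matrix.entryLinearMap (WittVector p F) A i j : Matrix (Fin 2) (Fin 2) A →ₗ[_] A) :
        Submodule _ _) : Set (Matrix (Fin 2) (Fin 2) A)) := fun i j =>
    (isClosed_maximalIdeal_of_compact A).preimage
      (f := fun x : Matrix (Fin 2) (Fin 2) A => x i j) (by fun_prop)
  constructor
  · refine wittLie_le (ρ := ρ) (hcl 0 0) (fun γ hγ => ?_) hx
    change pinkTheta γ 0 0 ∈ maximalIdeal A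
    have e : pinkTheta γ 0 0 = Ring.inverse 2 * ((γ - 1) 0 0 - (γ - 1) 1 1) := by
      simp only [pinkTheta, Matrix.trace_fin_two, Matrix.sub_apply, Matrix.smul_apply,
        Matrix.one_apply_eq, smul_eq_mul]
      linear_combination (-γ 0 0) * Ring.inverse_mul_cancel _ h2
    rw [e]
    exact Ideal.mul_mem_left _ _ (sub_mem (hγ.2.2 0 0) (hγ.2.2 1 1))
  · refine wittLie_le (ρ := ρ) (hcl 0 1) (fun γ hγ => ?_) hx
    change pinkTheta γ 0 1 ∈ maximalIdeal A
    have e : pinkTheta γ 0 1 = (γ - 1) 0 1 := by simp [pinkTheta]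
    rw [e]
    exact hγ.2.2 0 1

/-- A square root of `v` whose `p ^ n`-th powers tend to `1` lies in every closed subalgebra
containing `v`. -/
theorem mem_of_sq_mem {W : Type*} [CommRing W] [Algebra W A] [IsTopologicalRing A]
    {S : Subalgebra W A} (hS : IsClosed (S : Set A)) {q : ℕ} (hq : Odd q) {τ : A} (hτ : τ ^ 2 ∈ S)
    (hlim : Tendsto (fun n => τ ^ q ^ n) atTop (𝓝 1)) : τ ∈ S := by
  have h1 : Tendsto (fun n => τ ^ q ^ n * τ) atTop (𝓝 τ) := by
    simpa using hlim.mul_const τ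
  refine hS.mem_of_tendsto h1 (Eventually.of_forall fun n => ?_)
  obtain ⟨m, hm⟩ := hq.pow (n := n)
  have : τ ^ q ^ n * τ = (τ ^ 2) ^ (m + 1) := by rw [hm]; ring
  rw [this]
  exact pow_mem hτ _

end WellAdaptedLie

end

section

open Topology Filter IsLocalRing

/-! ### Generation of `A` and computation of the essential submodule. -/

section Main

variable {p : ℕ} [Fact p.Prime] {F : Type*} [Field F] [CharP F p]
  {A : Type*} [CommRing A] [IsLocalRing A] [Algebra (WittVector p F) A] [TopologicalSpace A]
  [IsTopologicalRing A] [CompactSpace A] [T2Space A]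
  {P : Type*} [Group P] {r : P →* GL (Fin 2) F} {ρ : P →* GL (Fin 2) A} {g₀ : P}

/-- The entries of the elements of `Γ` belong to every closed subalgebra containing the entries of
the Lie algebra. -/
theorem pinkGamma_apply_mem (hp : p ≠ 2) (hst : IsTorusStable (wittLie p F ρ))
    {S : Subalgebra (WittVector p F) A} (hS : IsClosed (S : Set A))
    (hA : ResidueFieldIs p F A)
    (hI : ∀ a, diagEmb (WittVector p F) A a ∈ wittLie p F ρ → a ∈ S)
    (hB : ∀ b, upperEmb (WittVector p F) A b ∈ wittLie p F ρ → b ∈ S)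
    {γ : Matrix (Fin 2) (Fin 2) A} (hγ : γ ∈ pinkGamma ρ) (i j : Fin 2) : γ i j ∈ S := by
  have h2 : Ring.inverse (2 : A) * 2 = 1 :=
    Ring.inverse_mul_cancel _ (isUnit_two_algebra p (F := F) hp)
  have hx := pinkTheta_mem_wittLie (p := p) (F := F) hγ
  have h00 := hI _ (hst.diagonal hx)
  have h01 := hB _ (hst.upper hx)
  have h10 := hB _ (hst.lower hx)
  set τ : A := Ring.inverse 2 * γ.trace with hτ
  have e00 : γ 0 0 = pinkTheta γ 0 0 + τ := by simp [pinkTheta, hτ]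
  have e01 : γ 0 1 = pinkTheta γ 0 1 := by simp [pinkTheta]
  have e10 : γ 1 0 = pinkTheta γ 1 0 := by simp [pinkTheta]
  have e11 : γ 1 1 = -pinkTheta γ 0 0 + τ := by
    rw [← trace_mem_wittLie hp hx]; simp [pinkTheta, hτ]
  -- Writing `γ` as its trace zero part plus the scalar `τ`, the condition `det γ = 1` determines `τ
  -- ^ 2`. Since `τ ≡ 1` modulo `𝔪`, its `p ^ n`-th powers tend to `1`.
  have hτ2 : τ ^ 2 = 1 + pinkTheta γ 0 0 ^ 2 + pinkTheta γ 0 1 * pinkTheta γ 1 0 := by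
    have := hγ.2.1
    rw [Matrix.det_fin_two, e00, e01, e10, e11] at this
    linear_combination this
  have hτm : τ - 1 ∈ maximalIdeal A := by
    have : τ - 1 = Ring.inverse 2 * ((γ - 1) 0 0 + (γ - 1) 1 1) := by
      rw [hτ, Matrix.trace_fin_two]
      simp only [Matrix.sub_apply, Matrix.one_apply_eq]
      linear_combination h2
    rw [this]
    exact Ideal.mul_mem_left _ _ (add_mem (hγ.2.2 0 0) (hγ.2.2 1 1))
  have hτS : τ ∈ S := by
    refine mem_of_sq_mem hS ((Fact.out : p.Prime).odd_of_ne_two hp) ?_ ?_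
    · rw [hτ2]
      exact add_mem (add_mem (one_mem _) (pow_mem h00 2)) (mul_mem h01 h10)
    · have := tendsto_one_add_pow (Fact.out : p.Prime) (isTopNil_of_mem_maximalIdeal hτm)
        (isTopNil_of_mem_maximalIdeal (natCast_p_mem_maximalIdeal p hA))
      simpa using this
  fin_cases i <;> fin_cases j
  · exact e00 ▸ add_mem h00 hτS
  · exact e01 ▸ h01
  · exact e10 ▸ h10
  · exact e11 ▸ add_mem (neg_mem h00) hτS

/-- Each `ρ g` is an element of `Γ` times a matrix of Teichmüller constants, so `t g` is a
`W(F)`-combination of entries of `Γ`, and `t` generates `A` topologically. -/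
theorem IsWellAdapted.eq_top_of_isClosed [TopologicalSpace P] {t : P → A} {d : P →* Aˣ}
    (hw : IsWellAdapted p r ρ g₀) (hadm : IsAdmissible p r t d) (hρ : IsTDRep t d ρ) (hp : p ≠ 2)
    (hA : ResidueFieldIs p F A) (hst : IsTorusStable (wittLie p F ρ))
    {S : Subalgebra (WittVector p F) A} (hS : IsClosed (S : Set A))
    (hI : ∀ a, diagEmb (WittVector p F) A a ∈ wittLie p F ρ → a ∈ S)
    (hB : ∀ b, upperEmb (WittVector p F) A b ∈ wittLie p F ρ → b ∈ S) : S = ⊤ := by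
  have hle : Algebra.adjoin (WittVector p F) (Set.range t) ≤ S := by
    refine Algebra.adjoin_le ?_
    rintro _ ⟨g, rfl⟩
    obtain ⟨k, hk, hgk⟩ := hw.exists_mul_teich g
    have hγ : (ρ k).val ∈ pinkGamma ρ := (hw.mem_pinkGamma_iff hadm hρ).2 ⟨k, hk, rfl⟩
    rw [SetLike.mem_coe, ← hρ.trace_eq, hgk, Matrix.trace]
    refine sum_mem fun i _ => ?_
    rw [Matrix.diag_apply, Matrix.mul_apply]
    exact sum_mem fun j _ => mul_mem (pinkGamma_apply_mem hp hst hS hA hI hB hγ i j)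
      (S.algebraMap_mem _)
  have h1 := (hadm.generated.mono hle).closure_eq
  rw [hS.closure_eq] at h1
  exact SetLike.coe_injective h1

theorem trace_mul_mem_essentialSubmodule {g : GL (Fin 2) A} (hg : g ∈ essentialS ρ)
    {x : Matrix (Fin 2) (Fin 2) A} (hx : x ∈ wittLie₂ p F ρ) :
    (g.val * x).trace ∈ essentialSubmodule p F ρ := by
  let f : Matrix (Fin 2) (Fin 2) A →ₗ[WittVector p F] A :=
    (Matrix.traceLinearMap (Fin 2) (WittVector p F) A).comp (LinearMap.mulLeft _ g.val)
  have hle : wittLie₂ p F ρ ≤ (essentialSubmodule p F ρ).comap f := by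
    refine Submodule.span_le.2 fun y hy => ?_
    exact le_iSup₂ (f := fun g (_ : g ∈ essentialS ρ) => Submodule.span (WittVector p F)
      {a | ∃ x ∈ pinkLie₂ ρ, a = (g.val * x).trace}) g hg (Submodule.subset_span ⟨y, hy, rfl⟩)
  exact hle hx

theorem isSquare_neg_det {g : GL (Fin 2) A} {x : F} (hx : x ≠ 0)
    (h : -g.val.det = teich p F A x * teich p F A x) :
    IsSquare (-Matrix.GeneralLinearGroup.det g) :=
  ⟨(isUnit_teich p hx).unit, Units.ext h⟩

variable (p F ρ) in
/-- The `W(F)`-module of the diagonal parts of the Lie algebra. -/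
noncomputable def diagPart : Submodule (WittVector p F) A :=
  (wittLie p F ρ).comap (diagEmb _ A)

variable (p F ρ) in
/-- The `W(F)`-module of the off-diagonal parts of the Lie algebra. -/
noncomputable def upperPart : Submodule (WittVector p F) A :=
  (wittLie p F ρ).comap (upperEmb _ A)

variable (p F ρ) in
/-- The `W(F)`-module of the diagonal parts of the derived Lie algebra. -/
noncomputable def diagPart₂ : Submodule (WittVector p F) A :=
  (wittLie₂ p F ρ).comap (diagEmb _ A)

variable (p F ρ) in
/-- The `W(F)`-module of the off-diagonal parts of the derived Lie algebra. -/
noncomputable def upperPart₂ : Submodule (WittVector p F) A :=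
  (wittLie₂ p F ρ).comap (upperEmb _ A)

/-- The bracket of `diag(a, -a)` with the upper triangular `b` is the upper triangular `2ab`. -/
theorem diagPart_mul_upperPart_le (hp : p ≠ 2) :
    diagPart p F ρ * upperPart p F ρ ≤ upperPart₂ p F ρ := by
  refine Submodule.mul_le.2 fun a ha b hb => ?_
  refine mem_of_isUnit_smul_mem (isUnit_two p hp) ?_
  have := bracket_mem_wittLie₂ ha hb
  change upperEmb (WittVector p F) A _ ∈ wittLie₂ p F ρ
  convert this using 1
  ext i j
  fin_cases i <;> fin_cases j <;> simp [upperEmb_apply, diagEmb_apply]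
  rw [two_smul]; ring

theorem upperPart_mul_upperPart_le (hst : IsTorusStable (wittLie p F ρ)) :
    upperPart p F ρ * upperPart p F ρ ≤ diagPart₂ p F ρ := by
  refine Submodule.mul_le.2 fun a ha b hb => ?_
  have := bracket_mem_wittLie₂ ha (hst.lower_mem hb)
  change diagEmb (WittVector p F) A _ ∈ wittLie₂ p F ρ
  convert this using 1
  ext i j
  fin_cases i <;> fin_cases j <;>
    simp [upperEmb_apply, diagEmb_apply, mul_comm]

theorem diagPart₂_le_of_isClosed (hst : IsTorusStable (wittLie p F ρ))
    {Y : Submodule (WittVector p F) A} (hY : IsClosed (Y : Set A))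
    (h : upperPart p F ρ * upperPart p F ρ ≤ Y) : diagPart₂ p F ρ ≤ Y := by
  intro c hc
  have hle : wittLie₂ p F ρ ≤ Y.comap (Matrix.entryLinearMap (WittVector p F) A 0 0) := by
    refine wittLie₂_le (hY.preimage
      (f := fun x : Matrix (Fin 2) (Fin 2) A => x 0 0) (by fun_prop)) fun x hx y hy => ?_
    have e : (x * y - y * x) 0 0 = x 0 1 * y 1 0 - y 0 1 * x 1 0 := by
      simp [Matrix.mul_apply]; ring
    rw [Submodule.mem_comap, Matrix.entryLinearMap_apply, e]
    exact sub_mem (h (Submodule.mul_mem_mul (hst.upper hx) (hst.lower hy)))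
      (h (Submodule.mul_mem_mul (hst.upper hy) (hst.lower hx)))
  exact hle hc

theorem upperPart₂_le_of_isClosed (hst : IsTorusStable (wittLie p F ρ))
    {Y : Submodule (WittVector p F) A} (hY : IsClosed (Y : Set A))
    (h : diagPart p F ρ * upperPart p F ρ ≤ Y) : upperPart₂ p F ρ ≤ Y := by
  intro c hc
  have hle : wittLie₂ p F ρ ≤ Y.comap (Matrix.entryLinearMap (WittVector p F) A 0 1) := by
    refine wittLie₂_le (hY.preimage
      (f := fun x : Matrix (Fin 2) (Fin 2) A => x 0 1) (by fun_prop)) fun x hx y hy => ?_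
    have e : (x * y - y * x) 0 1 =
        (2 : WittVector p F) • (x 0 0 * y 0 1) - (2 : WittVector p F) • (y 0 0 * x 0 1) := by
      simp [Matrix.mul_apply, hst.trace_zero x hx, hst.trace_zero y hy, two_smul]; ring
    rw [Submodule.mem_comap, Matrix.entryLinearMap_apply, e]
    exact sub_mem
      (Y.smul_mem _ (h (Submodule.mul_mem_mul (hst.diagonal hx) (hst.upper hy))))
      (Y.smul_mem _ (h (Submodule.mul_mem_mul (hst.diagonal hy) (hst.upper hx))))
  exact hle hc

/-- `Θ` does not change off-diagonal entries. Finite generation makes `B` closed, which allows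
passing from `Γ` to the closed Lie algebra it generates. -/
theorem IsWellAdapted.offDiagIdeal_eq_span_upperPart [TopologicalSpace P] [IsTopologicalGroup P]
    [CompactSpace P] [TotallyDisconnectedSpace P] {t : P → A} {d : P →* Aˣ}
    (hw : IsWellAdapted p r ρ g₀) (hadm : IsAdmissible p r t d) (hρ : IsTDRep t d ρ)
    (hA : ResidueFieldIs p F A) (hst : IsTorusStable (wittLie p F ρ)) :
    offDiagIdeal r ρ g₀ = Ideal.span (upperPart p F ρ : Set A) := by
  have hmem : ∀ γ : Matrix (Fin 2) (Fin 2) A, pinkTheta γ 0 1 = γ 0 1 := by simp [pinkTheta]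
  apply le_antisymm
  · rw [hw.offDiagIdeal_eq_span, Ideal.span_le]
    rintro _ ⟨k, hk, rfl⟩
    have hγ : (ρ k).val ∈ pinkGamma ρ := (hw.mem_pinkGamma_iff hadm hρ).2 ⟨k, hk, rfl⟩
    have := hst.upper (pinkTheta_mem_wittLie hγ)
    rw [hmem] at this
    exact Ideal.subset_span this
  · have hcl : IsClosed (offDiagIdeal r ρ g₀ : Set A) :=
      (Ideal.isCompact_of_fg (hw.offDiagIdeal_fg hA hadm hρ)).isClosed
    rw [Ideal.span_le]
    intro b hb
    have hle : wittLie p F ρ ≤ ((offDiagIdeal r ρ g₀).restrictScalars (WittVector p F)).comap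
        (Matrix.entryLinearMap (WittVector p F) A 0 1) := by
      refine wittLie_le (hcl.preimage
        (f := fun x : Matrix (Fin 2) (Fin 2) A => x 0 1) (by fun_prop)) fun γ hγ => ?_
      change pinkTheta γ 0 1 ∈ offDiagIdeal r ρ g₀
      obtain ⟨k, hk, rfl⟩ := (hw.mem_pinkGamma_iff hadm hρ).1 hγ
      rw [hmem, hw.offDiagIdeal_eq_span]
      exact Ideal.subset_span ⟨k, hk, rfl⟩
    exact hle hb

/-- The trace zero elements `diag(a, -a)` and `antidiag(b, c)` of the residual image, with `b c` a
square, recover the diagonal and off-diagonal parts of the derived Lie algebra. -/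
theorem IsWellAdapted.essentialSubmodule_eq_sup (hw : IsWellAdapted p r ρ g₀) (hp : p ≠ 2)
    (hst₂ : IsTorusStable (wittLie₂ p F ρ))
    (hideal : ∃ J : Ideal A, (J : Set A) = (diagPart₂ p F ρ ⊔ upperPart₂ p F ρ :
      Submodule (WittVector p F) A))
    (hdiag : ∃ h : P, (r h).val 0 1 = 0 ∧ (r h).val 1 0 = 0 ∧ (r h).val 0 0 ≠ 0 ∧
      (r h).val 1 1 = -(r h).val 0 0)
    (hS : ∃ x ∈ r.range, x ∉ diagSubgroup r g₀ ∧ x ∈ residualS r) :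
    essentialSubmodule p F ρ = diagPart₂ p F ρ ⊔ upperPart₂ p F ρ := by
  apply le_antisymm
  · obtain ⟨J, hJ⟩ := hideal
    have hJ' : J.restrictScalars (WittVector p F) = diagPart₂ p F ρ ⊔ upperPart₂ p F ρ :=
      SetLike.coe_injective hJ
    rw [← hJ']
    refine iSup₂_le fun g _ => Submodule.span_le.2 ?_
    rintro _ ⟨x, hx, rfl⟩
    have hx' : x ∈ wittLie₂ p F ρ := Submodule.subset_span hx
    have hd : ∀ {a}, a ∈ diagPart₂ p F ρ → a ∈ J := fun {a} ha => by
      have : a ∈ J.restrictScalars (WittVector p F) := hJ' ▸ Submodule.mem_sup_left ha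
      exact this
    have hu : ∀ {a}, a ∈ upperPart₂ p F ρ → a ∈ J := fun {a} ha => by
      have : a ∈ J.restrictScalars (WittVector p F) := hJ' ▸ Submodule.mem_sup_right ha
      exact this
    -- All entries of `x` lie in the ideal `J`, so the trace against an arbitrary `g` does too.
    have h00 : x 0 0 ∈ J := hd (hst₂.diagonal hx')
    have h01 : x 0 1 ∈ J := hu (hst₂.upper hx')
    have h10 : x 1 0 ∈ J := hu (hst₂.lower hx')
    have h11 : x 1 1 ∈ J := hst₂.trace_zero x hx' ▸ neg_mem h00
    change (g.val * x).trace ∈ J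
    rw [Matrix.trace_fin_two, Matrix.mul_apply, Matrix.mul_apply, Fin.sum_univ_two,
      Fin.sum_univ_two]
    exact add_mem (add_mem (J.mul_mem_left _ h00) (J.mul_mem_left _ h10))
      (add_mem (J.mul_mem_left _ h01) (J.mul_mem_left _ h11))
  · refine sup_le (fun c hc => ?_) (fun c hc => ?_)
    · obtain ⟨h, h01, h10, h0, h11⟩ := hdiag
      obtain ⟨h', -, hh⟩ := hw.eq_map_teich h
      have hg : ρ h' ∈ essentialS ρ := by
        refine ⟨⟨h', rfl⟩, ?_, isSquare_neg_det (p := p) h0 ?_⟩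
        · rw [hh, Matrix.trace_fin_two, Matrix.map_apply, Matrix.map_apply, h11, teich_neg p hp,
            add_neg_cancel]
        · rw [hh, Matrix.det_fin_two]
          simp only [Matrix.map_apply]
          rw [h11, h01, teich_neg p hp, teich_zero]
          ring
      have hm := trace_mul_mem_essentialSubmodule hg (show diagEmb _ A c ∈ wittLie₂ p F ρ from hc)
      have e : ((ρ h').val * diagEmb (WittVector p F) A c).trace =
          (WittVector.teichmuller p ((r h).val 0 0) * 2) • c := by
        rw [hh, mul_smul, two_smul, smul_eq_teich_mul]
        simp [Matrix.trace_fin_two, Matrix.mul_apply, diagEmb_apply, h11, teich_neg p hp]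
        ring
      rw [e] at hm
      refine mem_of_isUnit_smul_mem (IsUnit.mul ?_ (isUnit_two p hp)) hm
      exact WittVector.isUnit_of_coeff_zero_ne_zero _ (by rwa [WittVector.teichmuller_coeff_zero])
    · obtain ⟨x, ⟨h, rfl⟩, hxD, -, -, e, he⟩ := hS
      obtain ⟨h00, h11⟩ := hw.antidiag_of_notMem ⟨h, rfl⟩ hxD
      obtain ⟨h', -, hh⟩ := hw.eq_map_teich h
      -- For an antidiagonal matrix `-det` is the product of the two entries. By multiplicativity
      -- the Teichmüller lift of the square root is a square root for the lifted matrix, which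
      -- therefore lies in `S`.
      have hsq : (r h).val 0 1 * (r h).val 1 0 = e * e := by
        have := congrArg Units.val he
        rw [Units.val_neg, Units.val_mul] at this
        rw [← this]
        change _ = -(r h).val.det
        rw [Matrix.det_fin_two, h00]; ring
      have hc0 : (r h).val 1 0 ≠ 0 := fun h0 => by
        rw [h0, mul_zero] at hsq
        exact e.ne_zero (mul_self_eq_zero.1 hsq.symm)
      have hg : ρ h' ∈ essentialS ρ := by
        refine ⟨⟨h', rfl⟩, ?_, isSquare_neg_det (p := p) (x := (e : F)) e.ne_zero ?_⟩
        · rw [hh, Matrix.trace_fin_two, Matrix.map_apply, Matrix.map_apply, h00, h11, teich_zero,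
            add_zero]
        · rw [hh, Matrix.det_fin_two, ← teich_mul, ← hsq, teich_mul]
          simp only [Matrix.map_apply]
          rw [h00, h11, teich_zero]
          ring
      have hm := trace_mul_mem_essentialSubmodule hg (show upperEmb _ A c ∈ wittLie₂ p F ρ from hc)
      have e : ((ρ h').val * upperEmb (WittVector p F) A c).trace =
          WittVector.teichmuller p ((r h).val 1 0) • c := by
        rw [hh, smul_eq_teich_mul]
        simp [Matrix.trace_fin_two, Matrix.mul_apply, upperEmb_apply]
      rw [e] at hm
      refine mem_of_isUnit_smul_mem ?_ hm
      exact WittVector.isUnit_of_coeff_zero_ne_zero _ (by rwa [WittVector.teichmuller_coeff_zero])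

end Main

end

end DihedralEssential

theorem mainTheorem12
    -- the finite field `F` of odd characteristic `p`
    (p : ℕ) [Fact p.Prime] (hp : p ≠ 2)
    (F : Type*) [Field F] [Finite F] [CharP F p]
    -- the compact local `W(F)`-algebra `A` with residue field `F`
    (A : Type*) [CommRing A] [TopologicalSpace A] [IsTopologicalRing A] [CompactSpace A]
    [T2Space A] [IsLocalRing A] [Algebra (WittVector p F) A] (hA : ResidueFieldIs p F A)
    -- the profinite group and the admissible pseudo-deformation
    (P : Type*) [Group P] [TopologicalSpace P] [IsTopologicalGroup P] [CompactSpace P]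
    [TotallyDisconnectedSpace P]
    (r : P →* GL (Fin 2) F) (t : P → A) (d : P →* Aˣ) (hadm : IsAdmissible p r t d)
    -- the projective image is dihedral of order `n > 4`, `4 ∣ n`
    (n : ℕ) (hdih : IsDihedralOfOrder r n) (hn : 4 < n) (h4n : 4 ∣ n)
    -- a well-adapted representation `ρ`, with reduction `r`, and the attached subgroup `D`
    (ρ : P →* GL (Fin 2) A) (hρ : IsTDRep t d ρ) (g₀ : P) (hwell : IsWellAdapted p r ρ g₀)
    -- some element of the residual image outside `D` lies in `S̄`
    (hS : ∃ x ∈ r.range, x ∉ diagSubgroup r g₀ ∧ x ∈ residualS r)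
    -- the representation used to compute the essential submodule
    (ρ' : P →* GL (Fin 2) A) (hρ' : IsTDRep t d ρ') :
    -- the essential submodule is an ideal
    (∃ I : Ideal A, (I : Set A) = (essentialSubmodule p F ρ' : Set A)) ∧
    -- it equals `𝔪 B` up to `p B`
    (essentialSubmodule p F ρ' ⊔
        (Ideal.span {(p : A)} * offDiagIdeal r ρ g₀).restrictScalars (WittVector p F) =
      (IsLocalRing.maximalIdeal A * offDiagIdeal r ρ g₀).restrictScalars (WittVector p F)) ∧
    -- and it equals `𝔪 B` when `p A = 0`
    ((p : A) = 0 → essentialSubmodule p F ρ' =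
      (IsLocalRing.maximalIdeal A * offDiagIdeal r ρ g₀).restrictScalars (WittVector p F)) := by
  obtain ⟨h01, h10⟩ := hwell.residual_offDiag
  obtain ⟨hne, hdiag⟩ := exists_trace_zero_diagonal hwell.index_two h01 h10 hdih.1 hn h4n
  have hmul : ∀ x ∈ pinkGamma ρ, ∀ y ∈ pinkGamma ρ, x * y ∈ pinkGamma ρ :=
    fun x hx y hy => hwell.mul_mem_pinkGamma hadm hρ hx hy
  have hle := wittLie₂_le_wittLie (p := p) (F := F) hmul
  have hst : IsTorusStable (wittLie p F ρ) := hwell.isTorusStable hne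
    (fun x hx => trace_mem_wittLie hp hx)
    (fun h x hx => conj_mem_wittLie hA (fun γ hγ => hwell.conj_mem_pinkGamma hadm hρ h hγ) hx)
  have hst₂ : IsTorusStable (wittLie₂ p F ρ) := hwell.isTorusStable hne
    (fun x hx => trace_mem_wittLie hp (hle hx))
    (fun h x hx => conj_mem_wittLie₂ hA (fun γ hγ => hwell.conj_mem_pinkGamma hadm hρ h hγ) hx)
  have hIB := diagPart_mul_upperPart_le (F := F) (ρ := ρ) hp
  have hBB := upperPart_mul_upperPart_le hst
  have hKB : upperPart₂ p F ρ ≤ upperPart p F ρ := Submodule.comap_mono hle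
  have hJI : diagPart₂ p F ρ ≤ diagPart p F ρ := Submodule.comap_mono hle
  have hJc : IsClosed (diagPart₂ p F ρ : Set A) :=
    (isClosed_wittLie₂ hA).preimage continuous_diagEmb
  have hKc : IsClosed (upperPart₂ p F ρ : Set A) :=
    (isClosed_wittLie₂ hA).preimage continuous_upperEmb
  have hgen : ∀ S : Subalgebra (WittVector p F) A, IsClosed (S : Set A) →
      (∀ a ∈ diagPart p F ρ, a ∈ S) → (∀ b ∈ upperPart p F ρ, b ∈ S) → S = ⊤ :=
    fun S hcl hI hB => hwell.eq_top_of_isClosed hadm hρ hp hA hst hcl hI hB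
  have hideal := exists_ideal_eq_sup p hIB hBB hKB hJI hJc hKc
    (fun Y hY h => diagPart₂_le_of_isClosed hst hY h) hgen
  have hess : essentialSubmodule p F ρ' = diagPart₂ p F ρ ⊔ upperPart₂ p F ρ := by
    rw [hρ'.essentialSubmodule_eq p F hρ]
    exact hwell.essentialSubmodule_eq_sup hp hst₂ hideal hdiag hS
  have hsup := sup_sup_p_mul_eq p hA hIB hBB hKB hJI hJc hKc
    (fun Y hY h => diagPart₂_le_of_isClosed hst hY h)
    (fun Y hY h => upperPart₂_le_of_isClosed hst hY h)
    (fun a ha => (entry_mem_of_mem_wittLie hp ha).1)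
    (fun b hb => (entry_mem_of_mem_wittLie hp hb).2) hgen
    (hwell.offDiagIdeal_eq_span_upperPart hadm hρ hA hst) (hwell.offDiagIdeal_fg hA hadm hρ)
  rw [← hess] at hsup hideal
  refine ⟨hideal, hsup, fun hp0 => ?_⟩
  rw [← hsup, hp0, Ideal.span_singleton_zero, Ideal.bot_mul]
  simp
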